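/- Let $G$ be a locally compact, second countable (Hausdorff) topological group with a left Haar measure $\mu$, and let $A$ be a Polish $G$-module, i.e. a Polish Abelian topological group with a jointly continuous action of $G$ by automorphisms. For $n\ge 1$ let $\mathcal{C}(G^n,A)^G$ be the group of Haar-a.e. equivalence classes of measurable functions $\sigma:G^n\to A$ that are fixed by the diagonal action $(g\cdot\sigma)(g_1,\dots,g_n)=g\cdot\sigma(g^{-1}g_1,\dots,g^{-1}g_n)$ for every $g \in G$, and let \[d\sigma(g_1,\dots,g_{n+1})=\sum_{i=1}^{n+1}(-1)^{n+1-i}\sigma(g_1,\dots,\widehat{g_i},\dots,g_{n+1}).\] For $p\ge 0$ let $\mathrm{H}^p_{\mathrm m}(G,A)$ be the cohomology at $\mathcal{C}(G^{p+1},A)^G$ of the complex $0\to\mathcal{C}(G,A)^G\xrightarrow{d}\mathcal{C}(G^2,A)^G\xrightarrow{d}\mathcal{C}(G^3,A)^G\xrightarrow{d}\cdots$. A function $\gamma:G^{n}\to A$ is of \emph{type I} if every point has a neighbourhood on which $\gamma$ takes only finitely many values, and there is an open set of full $\mu^{n}$-measure on which $\gamma$ is locally constant. A function is \emph{almost type-I}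 if it is a limit of a sequence of type-I functions, uniformly on compact sets; it is \emph{regular} at a point $x_0$ if the type-I functions in such a sequence can be chosen so that each of them is constant on some neighbourhood of $x_0$. Theorem. For every $p\ge 0$, every class in $\mathrm{H}^p_{\mathrm m}(G,A)$ is represented by a Borel measurable function $f:G^{p+1}\to A$ such that: 1. $f$ is $G$-equivariant, $f(gg_1,\dots,gg_{p+1})=g\cdot f(g_1,\dots,g_{p+1})$, and satisfies $df=0$, both at every point; 2. $f$ is almost type-I and regular at the identity $(e,\dots,e)$ of $G^{p+1}$; 3. there is a dense $G_\delta$ set $S\subseteq G^{p+1}$ whose complement is $\mu^{p+1}$-null, with $(e,\dots,e)\in S$, such that $f$ is continuous at every point of $S$. -/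

import Mathlib

open MeasureTheory Filter Topology

namespace MooreCohomology

theorem quasiMeasurePreserving_removeNth {G : Type*} [MeasurableSpace G] (μ : Measure G)
    [SigmaFinite μ] {n : ℕ} (i : Fin (n + 1)) :
    Measure.QuasiMeasurePreserving (fun x : Fin (n + 1) → G => i.removeNth x)
      (Measure.pi fun _ => μ) (Measure.pi fun _ => μ) :=
  Measure.quasiMeasurePreserving_snd.comp
    (measurePreserving_piFinSuccAbove (fun _ => μ) i).quasiMeasurePreserving


/-- The alternating-sum differential on actual functions. -/
def dFun {G A : Type*} [AddCommGroup A] {n : ℕ} (f : (Fin n → G) → A) :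
    (Fin (n + 1) → G) → A :=
  fun x => ∑ i : Fin (n + 1), (-1 : ℤ) ^ (n - (i : ℕ)) • f (i.removeNth x)

theorem dFun_dFun {G A : Type*} [AddCommGroup A] {n : ℕ} (f : (Fin n → G) → A)
    (x : Fin (n + 2) → G) : dFun (dFun f) x = 0 := by
  have key : ∀ (i : Fin (n + 2)) (j : Fin (n + 1)),
      (-1 : ℤ) ^ (n + 1 - (i : ℕ)) * (-1) ^ (n - (j : ℕ)) +
        (-1) ^ (n + 1 - (i.succAbove j : ℕ)) * (-1) ^ (n - (j.predAbove i : ℕ)) = 0 := by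
    intro i j
    have hi := i.2
    have hj := j.2
    rcases lt_or_ge j.castSucc i with h | h
    · have h' : (j : ℕ) < i := h
      rw [Fin.succAbove_of_castSucc_lt _ _ h, Fin.predAbove_of_castSucc_lt _ _ h]
      simp only [Fin.val_castSucc, Fin.val_pred]
      rw [show n + 1 - (j : ℕ) = (n - j) + 1 by omega,
        show n - ((i : ℕ) - 1) = n + 1 - i by omega]
      ring
    · have h' : (i : ℕ) ≤ j := h
      rw [Fin.succAbove_of_le_castSucc _ _ h, Fin.predAbove_of_le_castSucc _ _ h]
      simp only [Fin.val_succ, Fin.coe_castPred]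
      rw [show n + 1 - ((j : ℕ) + 1) = n - j by omega,
        show n + 1 - (i : ℕ) = (n - i) + 1 by omega]
      ring
  simp only [dFun, Finset.smul_sum, smul_smul]
  rw [← Finset.sum_product']
  refine Finset.sum_involution (fun q _ => (q.1.succAbove q.2, q.2.predAbove q.1)) ?_ ?_ ?_ ?_
  · rintro ⟨i, j⟩ -
    rw [Fin.removeNth_removeNth_eq_swap x j i, ← add_smul, key i j, zero_smul]
  · rintro ⟨i, j⟩ - - h
    exact Fin.succAbove_ne i j (congrArg Prod.fst h)|>.elim
  · simp
  · rintro ⟨i, j⟩ -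
    ext1
    · exact Fin.succAbove_succAbove_predAbove i j
    · exact Fin.predAbove_predAbove_succAbove i j

section Cohomology

variable {G : Type*} [Group G] [TopologicalSpace G] [IsTopologicalGroup G]
  [LocallyCompactSpace G] [SecondCountableTopology G] [MeasurableSpace G] [BorelSpace G]
variable (μ : Measure G) [μ.IsHaarMeasure]
variable (A : Type*) [AddCommGroup A] [TopologicalSpace A] [IsTopologicalAddGroup A]

/-- The product measure `μ^n` on `G^n`; if `μ` is a left Haar measure on `G` then this is a left
Haar measure on `G^n`. -/
noncomputable abbrev powMeasure {G : Type*} [MeasurableSpace G] (μ : Measure G) (n : ℕ) :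
    Measure (Fin n → G) :=
  Measure.pi fun _ => μ

/-- The group `C(G^n, A)` of Haar-a.e. equivalence classes of measurable functions `G^n → A`. -/
abbrev Cochain {G : Type*} [MeasurableSpace G] (μ : Measure G) (A : Type*) [TopologicalSpace A]
    (n : ℕ) : Type _ :=
  (Fin n → G) →ₘ[powMeasure μ n] A

theorem measurePreserving_translate (n : ℕ) (g : G) :
    MeasurePreserving (fun (x : Fin n → G) i => g * x i) (powMeasure μ n) (powMeasure μ n) :=
  measurePreserving_pi _ _ fun _ => measurePreserving_mul_left μ g

variable {A} in
/-- The diagonal action of `g` on `C(G^n, A)`: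
`(g • φ)(x₁, …, xₙ) = g • φ(g⁻¹ x₁, …, g⁻¹ xₙ)`. -/
noncomputable def diagAct [DistribMulAction G A] [ContinuousSMul G A] {n : ℕ} (g : G) :
    Cochain μ A n →+ Cochain μ A n :=
  AddMonoidHom.mk'
    (fun φ => AEEqFun.comp (fun a : A => g • a) (continuous_const_smul g)
      (φ.compMeasurePreserving (fun x i => g⁻¹ * x i) (measurePreserving_translate μ n g⁻¹)))
    (by
      rintro ⟨φ, hφ⟩ ⟨ψ, hψ⟩
      exact AEEqFun.mk_eq_mk.2 (Eventually.of_forall fun x => smul_add g _ _))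

/-- The alternating-sum differential `C(G^n, A) → C(G^(n+1), A)`. The face that omits the last
variable has coefficient `+1`. -/
noncomputable def d (n : ℕ) : Cochain μ A n →+ Cochain μ A (n + 1) :=
  ∑ i : Fin (n + 1), (-1 : ℤ) ^ (n - (i : ℕ)) •
    AddMonoidHom.mk' (fun σ : Cochain μ A n =>
      σ.compQuasiMeasurePreserving (fun x => i.removeNth x) (quasiMeasurePreserving_removeNth μ i))
      (by rintro ⟨φ, hφ⟩ ⟨ψ, hψ⟩; rfl)

/-- The differential of a class is the class of the differential. -/
theorem coeFn_d {n : ℕ} (σ : Cochain μ A n) : d μ A n σ =ᵐ[powMeasure μ (n + 1)] dFun σ := by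
  unfold d dFun
  simp only [AddMonoidHom.finsetSum_apply]
  induction (Finset.univ : Finset (Fin (n + 1))) using Finset.induction_on with
  | empty => exact AEEqFun.coeFn_zero
  | insert a s ha ih =>
    simp only [Finset.sum_insert ha]
    refine (AEEqFun.coeFn_add _ _).trans (EventuallyEq.add ?_ ih)
    refine (AEEqFun.coeFn_smul _ _).trans ?_
    filter_upwards [AEEqFun.coeFn_compQuasiMeasurePreserving σ
      (quasiMeasurePreserving_removeNth μ a)] with x hx
    exact congrArg _ hx

theorem dFun_congr {n : ℕ} {f g : (Fin n → G) → A} (h : f =ᵐ[powMeasure μ n] g) :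
    dFun f =ᵐ[powMeasure μ (n + 1)] dFun g := by
  have : ∀ᵐ x ∂powMeasure μ (n + 1), ∀ i : Fin (n + 1), f (i.removeNth x) = g (i.removeNth x) :=
    ae_all_iff.2 fun i => (quasiMeasurePreserving_removeNth μ i).ae h
  filter_upwards [this] with x hx
  simp only [dFun, hx]

theorem d_d {n : ℕ} (σ : Cochain μ A n) : d μ A (n + 1) (d μ A n σ) = 0 := by
  refine AEEqFun.ext ((coeFn_d μ A _).trans (((dFun_congr μ A (coeFn_d μ A σ)).trans ?_).trans
    AEEqFun.coeFn_zero.symm))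
  exact Eventually.of_forall (dFun_dFun _)

variable [DistribMulAction G A] [ContinuousSMul G A]

theorem coeFn_diagAct {n : ℕ} (g : G) (φ : Cochain μ A n) :
    diagAct μ g φ =ᵐ[powMeasure μ n] fun x => g • φ (fun i => g⁻¹ * x i) := by
  refine (AEEqFun.coeFn_comp _ (continuous_const_smul g) _).trans ?_
  filter_upwards [AEEqFun.coeFn_compMeasurePreserving φ (measurePreserving_translate μ n g⁻¹)]
    with x hx
  exact congrArg (fun a => g • a) hx

theorem diagAct_d {n : ℕ} (g : G) (φ : Cochain μ A n) :
    diagAct μ g (d μ A n φ) = d μ A n (diagAct μ g φ) := by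
  refine AEEqFun.ext ((coeFn_diagAct μ A g _).trans (EventuallyEq.trans ?_
    ((coeFn_d μ A _).trans (dFun_congr μ A (coeFn_diagAct μ A g φ))).symm))
  filter_upwards [(measurePreserving_translate μ (n + 1) g⁻¹).quasiMeasurePreserving.ae
    (coeFn_d μ A φ)] with x hx
  rw [hx]
  simp only [dFun, Finset.smul_sum]
  exact Finset.sum_congr rfl fun i _ => smul_comm _ _ _

/-- The subgroup `C(G^n, A)^G` of classes that are fixed by the diagonal action. -/
noncomputable def invariants (n : ℕ) : AddSubgroup (Cochain μ A n) :=
  ⨅ g : G, (diagAct μ g).eqLocus (AddMonoidHom.id (Cochain μ A n))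

/-- `Z^p(G, A)`, the kernel of the differential on `C(G^(p+1), A)^G`. -/
noncomputable def cocycles (p : ℕ) : AddSubgroup (Cochain μ A (p + 1)) :=
  invariants μ A (p + 1) ⊓ (d μ A (p + 1)).ker

/-- `B^p(G, A)`, the image of the preceding term in the complex
`0 → C(G, A)^G → C(G², A)^G → C(G³, A)^G → ⋯`. -/
noncomputable def coboundaries : (p : ℕ) → AddSubgroup (Cochain μ A (p + 1))
  | 0 => ⊥
  | p + 1 => (invariants μ A (p + 1)).map (d μ A (p + 1))

/-- Coboundaries are cocycles. -/
theorem coboundaries_le_cocycles (p : ℕ) : coboundaries μ A p ≤ cocycles μ A p := by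
  cases p with
  | zero => exact bot_le
  | succ p =>
    rintro _ ⟨φ, hφ, rfl⟩
    refine ⟨AddSubgroup.mem_iInf.2 fun g => ?_, d_d μ A φ⟩
    exact (diagAct_d μ A g φ).trans (congrArg _ (AddSubgroup.mem_iInf.1 hφ g))

/-- Moore's measurable cohomology group `H^p_m(G, A) = Z^p(G, A) / B^p(G, A)`. -/
abbrev Hm (p : ℕ) : Type _ :=
  cocycles μ A p ⧸ (coboundaries μ A p).addSubgroupOf (cocycles μ A p)

end Cohomology

section TypeI

variable {X : Type*} [TopologicalSpace X] {A : Type*}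

/-- `f` is locally constant around `x`: it is constant on a neighbourhood of `x`. -/
def LocallyConstantAround (f : X → A) (x : X) : Prop :=
  ∀ᶠ y in 𝓝 x, f y = f x

/-- Type-I functions: locally finite-valued, and locally constant on an open set of full
measure. -/
def IsTypeI [MeasurableSpace X] (ν : Measure X) (f : X → A) : Prop :=
  (∀ x, ∃ V ∈ 𝓝 x, (f '' V).Finite) ∧
    ∃ U : Set X, IsOpen U ∧ ν Uᶜ = 0 ∧ ∀ x ∈ U, LocallyConstantAround f x

variable [AddCommGroup A] [TopologicalSpace A]

/-- Locally uniform convergence of a sequence of functions from a locally compact space to a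
topological group, that is, uniform convergence on compact sets. -/
def TendstoCompactly (γ : ℕ → X → A) (f : X → A) : Prop :=
  ∀ K : Set X, IsCompact K → ∀ V ∈ 𝓝 (0 : A), ∀ᶠ n in atTop, ∀ x ∈ K, γ n x - f x ∈ V

/-- Almost type-I functions: locally uniform limits of type-I functions. -/
def IsAlmostTypeI [MeasurableSpace X] (ν : Measure X) (f : X → A) : Prop :=
  ∃ γ : ℕ → X → A, (∀ n, IsTypeI ν (γ n)) ∧ TendstoCompactly γ f

/-- Regularity of an almost type-I function `f` at `x₀`: `f` is a locally uniform limit of type-I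
functions each of which is locally constant around `x₀`. -/
def IsRegularAt [MeasurableSpace X] (ν : Measure X) (f : X → A) (x₀ : X) : Prop :=
  ∃ γ : ℕ → X → A,
    (∀ n, IsTypeI ν (γ n) ∧ LocallyConstantAround (γ n) x₀) ∧ TendstoCompactly γ f

end TypeI

end MooreCohomology

/-!
A Polish Abelian group is complete with respect to a countable chain of neighbourhoods `V n` of
`0`, and then so is `C(G^m, A)` with respect to the classes that are small in measure, by
Borel–Cantelli. Without invariants, the complex `C(G^m, A)` is exact with open differentials:
freezing the last variable of a cocycle at a generic point gives a primitive, which by Fubini and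
Markov can be chosen small if the cocycle is small. Hence a function with values in the cocycles
that is a locally uniform limit of type-I functions lifts through `d` to a function of the same
kind, as the sum of lifts of the differences of its approximations. Continuity of the action of
`G` shows that `x ↦ x₀ • u (x₀⁻¹ x₁, …, x₀⁻¹ xₖ)` is such a limit if `u` is, so that lifts can be
made equivariant. Starting from a cocycle of `p + 1` variables, viewed as a constant with values
in `C(G^(p+1), A)`, repeatedly lifting the differential in the argument shifts one variable after
another from the coefficients to the argument, and ends with a function on `G^(p+1)` with values
in `C(G^0, A) = A`, every value of which is well defined. It differs from the given cocycle by a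
coboundary, as the rows of equivariant functions in the double complex of functions on `G^k × G^m`
are exact.
-/

namespace MooreCohomology

open scoped ENNReal

section PolishComplete

theorem isGδ_range_of_isDenseInducing {X Y : Type*} [TopologicalSpace X] [TopologicalSpace Y]
    [TopologicalSpace.IsCompletelyMetrizableSpace X] [T2Space Y] {i : X → Y}
    (hi : IsDenseInducing i) : IsGδ (Set.range i) := by
  let := TopologicalSpace.upgradeIsCompletelyMetrizable X
  let O (n : ℕ) : Set Y :=
    ⋃₀ {U | IsOpen U ∧ ∀ a ∈ i ⁻¹' U, ∀ b ∈ i ⁻¹' U, dist a b < 1 / ((n : ℝ) + 1)}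
  suffices Set.range i = ⋂ n, O n from
    this ▸ .iInter_of_isOpen fun n => isOpen_sUnion fun U hU => hU.1
  refine Set.Subset.antisymm ?_ fun y hy => ?_
  · rintro _ ⟨x, rfl⟩
    refine Set.mem_iInter.2 fun n => ?_
    have hball : Metric.ball x (1 / ((n : ℝ) + 1) / 2) ∈ comap i (𝓝 (i x)) :=
      hi.nhds_eq_comap x ▸ Metric.ball_mem_nhds x (half_pos Nat.one_div_pos_of_nat)
    obtain ⟨t, ht, ht_ball⟩ := hball
    obtain ⟨U, hUt, hU, hxU⟩ := mem_nhds_iff.1 ht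
    refine ⟨U, ⟨hU, fun a ha b hb => ?_⟩, hxU⟩
    calc dist a b ≤ dist a x + dist b x := dist_triangle_right a b x
      _ < 1 / ((n : ℝ) + 1) / 2 + 1 / ((n : ℝ) + 1) / 2 :=
        add_lt_add (ht_ball (hUt ha)) (ht_ball (hUt hb))
      _ = 1 / ((n : ℝ) + 1) := add_halves _
  · have hne : (comap i (𝓝 y)).NeBot := hi.comap_nhds_neBot y
    have hcauchy : Cauchy (comap i (𝓝 y)) := Metric.cauchy_iff.2 ⟨hne, fun ε hε => by
      obtain ⟨n, hn⟩ := exists_nat_one_div_lt hε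
      obtain ⟨U, ⟨hU, hU_dist⟩, hyU⟩ := Set.mem_iInter.1 hy n
      exact ⟨i ⁻¹' U, preimage_mem_comap (hU.mem_nhds hyU),
        fun a ha b hb => (hU_dist a ha b hb).trans hn⟩⟩
    obtain ⟨x, hx⟩ := CompleteSpace.complete hcauchy
    exact ⟨x, tendsto_nhds_unique ((hi.continuous.tendsto x).mono_left hx) tendsto_comap⟩

theorem completeSpace_of_isCompletelyMetrizableSpace (A : Type*) [AddCommGroup A] [UniformSpace A]
    [IsUniformAddGroup A] [TopologicalSpace.IsCompletelyMetrizableSpace A] : CompleteSpace A := by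
  have := IsUniformAddGroup.uniformity_countably_generated (α := A)
  let := UniformSpace.pseudoMetricSpace A
  let i : A → UniformSpace.Completion A := (↑)
  have hi : IsDenseInducing i := UniformSpace.Completion.isDenseInducing_coe
  have hGδ : IsGδ (Set.range i) := isGδ_range_of_isDenseInducing hi
  -- By Baire, the comeagre subgroup `range i` meets each of its translates.
  have hsurj : Function.Surjective i := fun x => by
    let τ : UniformSpace.Completion A ≃ₜ UniformSpace.Completion A := Homeomorph.addRight x
    have hdense : Dense (Set.range i ∩ τ ⁻¹' Set.range i) :=
      Dense.inter_of_Gδ hGδ (hGδ.preimage τ.continuous) hi.dense (hi.dense.preimage τ.isOpenMap)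
    obtain ⟨y, ⟨a, hay⟩, b, hby : i b = y + x⟩ := hdense.nonempty
    exact ⟨b - a, by
      rw [show i (b - a) = i b - i a from UniformSpace.Completion.coe_sub b a, hby, hay,
        add_sub_cancel_left]⟩
  exact ((UniformSpace.Completion.isUniformInducing_coe A).completeSpace_congr hsurj).2
    inferInstance

end PolishComplete

section Chain

/-- A decreasing sequence of symmetric subsets of an Abelian group containing zero, each of which
contains the sum of two copies of the next one: a countable basis at zero of a group topology, of
which only the sets themselves are needed. -/
structure IsAddChain {E : Type*} [AddCommGroup E] (W : ℕ → Set E) : Prop where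
  zero_mem : ∀ n, 0 ∈ W n
  neg_mem : ∀ n, ∀ a ∈ W n, -a ∈ W n
  add_mem : ∀ n, ∀ a ∈ W (n + 1), ∀ b ∈ W (n + 1), a + b ∈ W n

/-- Completeness of a chain: a series with `n`-th term in `W n` for `n ≥ N` converges at a definite
rate. The shift by `3` absorbs the loss in passing to the limit. -/
def IsCompleteChain {E : Type*} [AddCommGroup E] (W : ℕ → Set E) : Prop :=
  ∀ (a : ℕ → E) (N : ℕ), (∀ n, N ≤ n → a n ∈ W n) →
    ∃ s, ∀ n, N ≤ n → ∑ i ∈ Finset.range (n + 3), a i - s ∈ W n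

variable {E : Type*} [AddCommGroup E] {W : ℕ → Set E}

theorem IsAddChain.antitone (hW : IsAddChain W) : Antitone W :=
  antitone_nat_of_succ_le fun n a ha => by
    simpa only [add_zero] using hW.add_mem n a ha 0 (hW.zero_mem _)

theorem IsAddChain.sub_mem (hW : IsAddChain W) {n : ℕ} {a b : E} (ha : a ∈ W (n + 1))
    (hb : b ∈ W (n + 1)) : a - b ∈ W n :=
  sub_eq_add_neg a b ▸ hW.add_mem n a ha (-b) (hW.neg_mem _ b hb)

theorem IsAddChain.sum_Ico_mem (hW : IsAddChain W) {a : ℕ → E} (N M : ℕ)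
    (ha : ∀ n, N + 1 ≤ n → n < M → a n ∈ W n) : ∑ i ∈ Finset.Ico (N + 1) M, a i ∈ W N := by
  induction hk : M - (N + 1) generalizing N with
  | zero => exact Finset.Ico_eq_empty_of_le (Nat.le_of_sub_eq_zero hk) ▸ hW.zero_mem _
  | succ k ih =>
    have hM : N + 1 < M := by omega
    rw [Finset.sum_eq_sum_Ico_succ_bot hM]
    exact hW.add_mem N _ (ha _ le_rfl hM) _ (ih (N + 1) (fun n hn => ha n (by omega)) (by omega))

end Chain

section NhdsChain

/-- An additive chain of open sets that form a neighbourhood basis of zero. -/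
structure IsNhdsChain {A : Type*} [AddCommGroup A] [TopologicalSpace A] (V : ℕ → Set A) : Prop
    extends IsAddChain V where
  isOpen : ∀ n, IsOpen (V n)
  exists_subset : ∀ U ∈ 𝓝 (0 : A), ∃ n, V n ⊆ U

variable {A : Type*} [AddCommGroup A] [TopologicalSpace A]

open scoped Pointwise in
theorem exists_isNhdsChain [IsTopologicalAddGroup A] [FirstCountableTopology A] :
    ∃ V : ℕ → Set A, IsNhdsChain V := by
  obtain ⟨u, hu, hu_add⟩ := IsTopologicalAddGroup.exists_antitone_basis_nhds_zero A
  have zero_mem (n : ℕ) : (0 : A) ∈ interior (u n) := mem_interior_iff_mem_nhds.2 (hu.mem n)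
  have add_mem (n : ℕ) {a b : A} (ha : a ∈ interior (u (n + 1))) (hb : b ∈ interior (u (n + 1))) :
      a + b ∈ interior (u n) :=
    interior_maximal ((Set.add_subset_add interior_subset interior_subset).trans (hu_add n))
      isOpen_interior.add_left (Set.add_mem_add ha hb)
  refine ⟨fun n => interior (u n) ∩ -interior (u n), ⟨fun n => ⟨zero_mem n, ?_⟩,
    fun n a ⟨ha, ha'⟩ => ⟨ha', ?_⟩, fun n a ⟨ha, ha'⟩ b ⟨hb, hb'⟩ => ⟨add_mem n ha hb, ?_⟩⟩,
    fun n => isOpen_interior.inter isOpen_interior.neg, fun U hU => ?_⟩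
  · simpa only [Set.mem_neg, neg_zero] using zero_mem n
  · simpa only [Set.mem_neg, neg_neg] using ha
  · rw [Set.mem_neg, neg_add]
    exact add_mem n ha' hb'
  · obtain ⟨n, -, hn⟩ := hu.1.mem_iff.1 hU
    exact ⟨n, Set.inter_subset_left.trans (interior_subset.trans hn)⟩

variable {V : ℕ → Set A}

theorem IsNhdsChain.mem_nhds (hV : IsNhdsChain V) (n : ℕ) : V n ∈ 𝓝 (0 : A) :=
  (hV.isOpen n).mem_nhds (hV.zero_mem n)

variable [IsTopologicalAddGroup A]

theorem IsNhdsChain.tendsto_iff (hV : IsNhdsChain V) {ι : Type*} {l : Filter ι} {a : ι → A}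
    {b : A} : Tendsto a l (𝓝 b) ↔ ∀ n, ∀ᶠ i in l, a i - b ∈ V n := by
  rw [← tendsto_sub_nhds_zero_iff]
  refine ⟨fun h n => h (hV.mem_nhds n), fun h U hU => ?_⟩
  obtain ⟨n, hn⟩ := hV.exists_subset U hU
  exact (h n).mono fun i hi => hn hi

theorem IsNhdsChain.mem_of_tendsto (hV : IsNhdsChain V) {ι : Type*} {l : Filter ι} [l.NeBot]
    {a : ι → A} {b : A} {n : ℕ} (h : Tendsto a l (𝓝 b)) (ha : ∀ᶠ i in l, a i ∈ V (n + 1)) :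
    b ∈ V n := by
  obtain ⟨i, hi_close, hi_mem⟩ := ((hV.tendsto_iff.1 h (n + 1)).and ha).exists
  simpa only [sub_sub_cancel] using hV.sub_mem hi_mem hi_close

theorem IsNhdsChain.exists_tendsto_sum (hV : IsNhdsChain V)
    [TopologicalSpace.IsCompletelyMetrizableSpace A] {a : ℕ → A} {N : ℕ}
    (ha : ∀ n, N ≤ n → a n ∈ V n) :
    ∃ s, Tendsto (fun n => ∑ i ∈ Finset.range n, a i) atTop (𝓝 s) := by
  let : UniformSpace A := IsTopologicalAddGroup.rightUniformSpace A
  have : IsUniformAddGroup A := isUniformAddGroup_of_addCommGroup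
  have := completeSpace_of_isCompletelyMetrizableSpace A
  refine cauchySeq_tendsto_of_complete (cauchySeq_iff.2 fun U hU => ?_)
  rw [uniformity_eq_comap_nhds_zero A, mem_comap] at hU
  obtain ⟨t, ht, htU⟩ := hU
  obtain ⟨n, hn⟩ := hV.exists_subset t ht
  have tail_mem (k : ℕ) (hk : n + N + 2 ≤ k) :
      ∑ i ∈ Finset.range k, a i - ∑ i ∈ Finset.range (n + N + 2), a i ∈ V (n + 1) := by
    rw [← Finset.sum_Ico_eq_sub _ hk]
    exact hV.antitone (by omega) (hV.sum_Ico_mem (n + N + 1) k fun m hm _ => ha m (by omega))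
  refine ⟨n + N + 2, fun k hk l hl => htU (hn ?_)⟩
  simpa only [sub_sub_sub_cancel_right] using hV.sub_mem (tail_mem l hl) (tail_mem k hk)

end NhdsChain

section BorelTypeI

variable {X Y : Type*} [TopologicalSpace X] [MeasurableSpace X] {E F H : Type*}

/-- Type-I functions that are locally constant around `x₀`, with Borel fibres: on the null
set where a type-I function need not be locally constant its values are arbitrary, so measurability
has to be required separately. -/
structure IsBorelTypeIAt (ν : Measure X) (x₀ : X) (f : X → E) : Prop where
  exists_finite_image : ∀ x, ∃ V ∈ 𝓝 x, (f '' V).Finite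
  exists_isOpen : ∃ U : Set X, IsOpen U ∧ x₀ ∈ U ∧ ν Uᶜ = 0 ∧ ∀ x ∈ U, LocallyConstantAround f x
  measurableSet_preimage : ∀ s : Set E, MeasurableSet (f ⁻¹' s)

variable {ν : Measure X} {x₀ : X} {f : X → E}

theorem IsBorelTypeIAt.isTypeI (hf : IsBorelTypeIAt ν x₀ f) : IsTypeI ν f := by
  obtain ⟨U, hU, -, hU_null, hU_const⟩ := hf.exists_isOpen
  exact ⟨hf.exists_finite_image, U, hU, hU_null, hU_const⟩

theorem IsBorelTypeIAt.locallyConstantAround (hf : IsBorelTypeIAt ν x₀ f) :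
    LocallyConstantAround f x₀ := by
  obtain ⟨U, -, hx₀, -, hU_const⟩ := hf.exists_isOpen
  exact hU_const _ hx₀

theorem IsBorelTypeIAt.finite_image (hf : IsBorelTypeIAt ν x₀ f) {K : Set X} (hK : IsCompact K) :
    (f '' K).Finite := by
  choose V hV hV_finite using hf.exists_finite_image
  obtain ⟨t, -, ht⟩ := hK.elim_nhds_subcover V fun x _ => hV x
  refine (t.finite_toSet.biUnion fun x _ => hV_finite x).subset ?_
  rintro _ ⟨x, hx, rfl⟩
  obtain ⟨y, hy, hxy⟩ := Set.mem_iUnion₂.1 (ht hx)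
  exact Set.mem_iUnion₂.2 ⟨y, hy, x, hxy, rfl⟩

theorem IsBorelTypeIAt.countable_range [SigmaCompactSpace X] (hf : IsBorelTypeIAt ν x₀ f) :
    (Set.range f).Countable := by
  rw [← Set.image_univ, ← iUnion_compactCovering, Set.image_iUnion]
  exact Set.countable_iUnion fun n => (hf.finite_image (isCompact_compactCovering X n)).countable

theorem IsBorelTypeIAt.const (ν : Measure X) (x₀ : X) (a : E) :
    IsBorelTypeIAt ν x₀ fun _ => a where
  exists_finite_image _ := ⟨Set.univ, univ_mem, (Set.finite_singleton a).subset (by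
    rintro _ ⟨y, -, rfl⟩; rfl)⟩
  exists_isOpen := ⟨Set.univ, isOpen_univ, trivial, by rw [Set.compl_univ, measure_empty],
    fun _ _ => Eventually.of_forall fun _ => rfl⟩
  measurableSet_preimage s := measurable_const (MeasurableSpace.measurableSet_top (s := s))

theorem IsBorelTypeIAt.map (hf : IsBorelTypeIAt ν x₀ f) (h : E → F) :
    IsBorelTypeIAt ν x₀ fun x => h (f x) where
  exists_finite_image x := by
    obtain ⟨V, hV, hV_finite⟩ := hf.exists_finite_image x
    refine ⟨V, hV, (hV_finite.image h).subset ?_⟩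
    rintro _ ⟨y, hy, rfl⟩
    exact ⟨f y, ⟨y, hy, rfl⟩, rfl⟩
  exists_isOpen := by
    obtain ⟨U, hU, hx₀, hU_null, hU_const⟩ := hf.exists_isOpen
    exact ⟨U, hU, hx₀, hU_null, fun x hx => (hU_const x hx).mono fun y hy => congrArg h hy⟩
  measurableSet_preimage s := hf.measurableSet_preimage (h ⁻¹' s)

theorem IsBorelTypeIAt.map₂ [SigmaCompactSpace X] {g : X → F} (hf : IsBorelTypeIAt ν x₀ f)
    (hg : IsBorelTypeIAt ν x₀ g) (h : E → F → H) :
    IsBorelTypeIAt ν x₀ fun x => h (f x) (g x) where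
  exists_finite_image x := by
    obtain ⟨V, hV, hfV⟩ := hf.exists_finite_image x
    obtain ⟨V', hV', hgV'⟩ := hg.exists_finite_image x
    refine ⟨V ∩ V', inter_mem hV hV', (hfV.image2 h hgV').subset ?_⟩
    rintro _ ⟨y, hy, rfl⟩
    exact ⟨f y, ⟨y, hy.1, rfl⟩, g y, ⟨y, hy.2, rfl⟩, rfl⟩
  exists_isOpen := by
    obtain ⟨U, hU, hx₀, hU_null, hf_const⟩ := hf.exists_isOpen
    obtain ⟨U', hU', hx₀', hU'_null, hg_const⟩ := hg.exists_isOpen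
    refine ⟨U ∩ U', hU.inter hU', ⟨hx₀, hx₀'⟩, ?_, fun x hx => ?_⟩
    · rw [Set.compl_inter]
      exact measure_union_null hU_null hU'_null
    · filter_upwards [hf_const x hx.1, hg_const x hx.2] with y hfy hgy
      rw [hfy, hgy]
  measurableSet_preimage s := by
    have preimage_eq : (fun x => h (f x) (g x)) ⁻¹' s =
        ⋃ a ∈ Set.range f, f ⁻¹' {a} ∩ g ⁻¹' (h a ⁻¹' s) := by
      ext x
      simp only [Set.mem_preimage, Set.mem_iUnion, Set.mem_inter_iff, Set.mem_singleton_iff]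
      exact ⟨fun hx => ⟨f x, ⟨x, rfl⟩, rfl, hx⟩, fun ⟨_, _, ha, hx⟩ => ha ▸ hx⟩
    rw [preimage_eq]
    exact .biUnion hf.countable_range fun a _ =>
      (hf.measurableSet_preimage _).inter (hg.measurableSet_preimage _)

theorem IsBorelTypeIAt.comp_continuous [TopologicalSpace Y] [MeasurableSpace Y] {ν' : Measure Y}
    {π : X → Y} {f : Y → E} (hf : IsBorelTypeIAt ν' (π x₀) f) (hπ : Continuous π)
    (hπ_qmp : Measure.QuasiMeasurePreserving π ν ν') : IsBorelTypeIAt ν x₀ fun x => f (π x) where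
  exists_finite_image x := by
    obtain ⟨V, hV, hV_finite⟩ := hf.exists_finite_image (π x)
    refine ⟨π ⁻¹' V, hπ.continuousAt hV, hV_finite.subset ?_⟩
    rintro _ ⟨y, hy, rfl⟩
    exact ⟨π y, hy, rfl⟩
  exists_isOpen := by
    obtain ⟨U, hU, hx₀, hU_null, hU_const⟩ := hf.exists_isOpen
    exact ⟨π ⁻¹' U, hU.preimage hπ, hx₀, hπ_qmp.preimage_null hU_null,
      fun x hx => hπ.continuousAt.eventually (hU_const _ hx)⟩
  measurableSet_preimage s := hπ_qmp.measurable (hf.measurableSet_preimage s)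

/-- Open sets along which functions may be cut and pasted without leaving the class of type-I
functions that are locally constant around `x₀`. -/
structure IsNullFrontierOpen (ν : Measure X) (x₀ : X) (U : Set X) : Prop where
  isOpen : IsOpen U
  measure_frontier : ν (frontier U) = 0
  notMem_frontier : x₀ ∉ frontier U

theorem IsNullFrontierOpen.empty (ν : Measure X) (x₀ : X) : IsNullFrontierOpen ν x₀ ∅ :=
  ⟨isOpen_empty, by rw [frontier_empty, measure_empty], by
    rw [frontier_empty]; exact Set.notMem_empty x₀⟩

theorem IsNullFrontierOpen.union {U V : Set X} (hU : IsNullFrontierOpen ν x₀ U)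
    (hV : IsNullFrontierOpen ν x₀ V) : IsNullFrontierOpen ν x₀ (U ∪ V) := by
  have frontier_subset : frontier (U ∪ V) ⊆ frontier U ∪ frontier V :=
    (frontier_union_subset U V).trans
      (Set.union_subset_union Set.inter_subset_left Set.inter_subset_right)
  exact ⟨hU.isOpen.union hV.isOpen, measure_mono_null frontier_subset
    (measure_union_null hU.measure_frontier hV.measure_frontier),
    fun h => (frontier_subset h).elim hU.notMem_frontier hV.notMem_frontier⟩

theorem IsBorelTypeIAt.piecewise [OpensMeasurableSpace X] {U : Set X} [DecidablePred (· ∈ U)]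
    (hU : IsNullFrontierOpen ν x₀ U) {g : X → E} (hf : IsBorelTypeIAt ν x₀ f)
    (hg : IsBorelTypeIAt ν x₀ g) : IsBorelTypeIAt ν x₀ (U.piecewise f g) where
  exists_finite_image x := by
    obtain ⟨V, hV, hfV⟩ := hf.exists_finite_image x
    obtain ⟨V', hV', hgV'⟩ := hg.exists_finite_image x
    refine ⟨V ∩ V', inter_mem hV hV', (hfV.union hgV').subset ?_⟩
    rintro _ ⟨y, hy, rfl⟩
    by_cases hyU : y ∈ U
    · exact Set.piecewise_eq_of_mem U f g hyU ▸ .inl ⟨y, hy.1, rfl⟩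
    · exact Set.piecewise_eq_of_notMem U f g hyU ▸ .inr ⟨y, hy.2, rfl⟩
  exists_isOpen := by
    obtain ⟨Uf, hUf, hx₀f, hUf_null, hf_const⟩ := hf.exists_isOpen
    obtain ⟨Ug, hUg, hx₀g, hUg_null, hg_const⟩ := hg.exists_isOpen
    refine ⟨Uf ∩ Ug ∩ (frontier U)ᶜ, (hUf.inter hUg).inter isClosed_frontier.isOpen_compl,
      ⟨⟨hx₀f, hx₀g⟩, hU.notMem_frontier⟩, ?_, fun x hx => ?_⟩
    · rw [Set.compl_inter, Set.compl_inter, compl_compl]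
      exact measure_union_null (measure_union_null hUf_null hUg_null) hU.measure_frontier
    · by_cases hxU : x ∈ U
      · filter_upwards [hf_const x hx.1.1, hU.isOpen.mem_nhds hxU] with y hy hyU
        rw [Set.piecewise_eq_of_mem _ _ _ hyU, Set.piecewise_eq_of_mem _ _ _ hxU, hy]
      · have hx_closure : x ∉ closure U := fun h => hx.2 (hU.isOpen.frontier_eq ▸ ⟨h, hxU⟩)
        filter_upwards [hg_const x hx.1.2, isClosed_closure.isOpen_compl.mem_nhds hx_closure]
          with y hy hyU
        rw [Set.piecewise_eq_of_notMem _ _ _ fun h => hyU (subset_closure h),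
          Set.piecewise_eq_of_notMem _ _ _ hxU, hy]
  measurableSet_preimage s := by
    rw [Set.piecewise_preimage]
    exact hU.isOpen.measurableSet.ite (hf.measurableSet_preimage s) (hg.measurableSet_preimage s)

variable [TopologicalSpace.MetrizableSpace X] [OpensMeasurableSpace X]

theorem exists_isNullFrontierOpen_subset (ν : Measure X) [SFinite ν] (x₀ : X) {x : X} {s : Set X}
    (hs : s ∈ 𝓝 x) : ∃ U ⊆ s, x ∈ U ∧ IsNullFrontierOpen ν x₀ U := by
  let := TopologicalSpace.metrizableSpaceMetric X
  obtain ⟨ε, hε, hεs⟩ := Metric.mem_nhds_iff.1 hs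
  obtain ⟨δ, hδ, hδε, hδ_dist⟩ : ∃ δ > 0, δ ≤ ε ∧ (x₀ ≠ x → δ ≤ dist x₀ x) := by
    by_cases hx : x₀ = x
    · exact ⟨ε, hε, le_rfl, fun h => (h hx).elim⟩
    · exact ⟨min ε (dist x₀ x), lt_min hε (dist_pos.2 hx), min_le_left _ _,
        fun _ => min_le_right _ _⟩
  obtain ⟨r, ⟨hr_pos, hrδ⟩, hr_null⟩ := exists_null_frontier_thickening ν {x} hδ
  rw [Metric.thickening_singleton] at hr_null
  refine ⟨Metric.ball x r, (Metric.ball_subset_ball (hrδ.le.trans hδε)).trans hεs,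
    Metric.mem_ball_self hr_pos, Metric.isOpen_ball, hr_null, fun h => ?_⟩
  have hx₀r : dist x₀ x = r := Metric.frontier_ball_subset_sphere h
  have hne : x₀ ≠ x := dist_pos.1 (hx₀r ▸ hr_pos)
  exact (hδ_dist hne).not_gt (hx₀r ▸ hrδ)

theorem exists_isBorelTypeIAt_of_eventually (ν : Measure X) [SFinite ν] (x₀ : X)
    {P : X → E → Prop} (hP : ∀ x, ∃ a, ∀ᶠ y in 𝓝 x, P y a) {K : Set X} (hK : IsCompact K) :
    ∃ f : X → E, IsBorelTypeIAt ν x₀ f ∧ ∀ x ∈ K, P x (f x) := by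
  classical
  suffices ∃ U, IsNullFrontierOpen ν x₀ U ∧ K ⊆ U ∧
      ∃ f : X → E, IsBorelTypeIAt ν x₀ f ∧ ∀ x ∈ U, P x (f x) by
    obtain ⟨U, -, hKU, f, hf, hfU⟩ := this
    exact ⟨f, hf, fun x hx => hfU x (hKU hx)⟩
  refine hK.induction_on ?_ ?_ ?_ ?_
  · obtain ⟨a, -⟩ := hP x₀
    exact ⟨∅, .empty ν x₀, le_rfl, fun _ => a, .const ν x₀ a, fun _ h => h.elim⟩
  · rintro s t hst ⟨U, hU, htU, hf⟩
    exact ⟨U, hU, hst.trans htU, hf⟩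
  · rintro s t ⟨U, hU, hsU, f, hf, hfU⟩ ⟨V, hV, htV, g, hg, hgV⟩
    refine ⟨U ∪ V, hU.union hV, Set.union_subset_union hsU htV, U.piecewise f g,
      hf.piecewise hU hg, fun x hx => ?_⟩
    by_cases hxU : x ∈ U
    · exact Set.piecewise_eq_of_mem U f g hxU ▸ hfU x hxU
    · exact Set.piecewise_eq_of_notMem U f g hxU ▸ hgV x (hx.resolve_left hxU)
  · intro x _
    obtain ⟨a, ha⟩ := hP x
    obtain ⟨U, hUP, hxU, hU⟩ := exists_isNullFrontierOpen_subset ν x₀ ha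
    exact ⟨U, mem_nhdsWithin_of_mem_nhds (hU.isOpen.mem_nhds hxU), U, hU, le_rfl, fun _ => a,
      .const ν x₀ a, fun y hy => hUP hy⟩

end BorelTypeI

section TypeILimit

variable {X Y : Type*} [TopologicalSpace X] [MeasurableSpace X] {E F : Type*} [AddCommGroup E]
  [AddCommGroup F]

/-- Limits of Borel type-I functions that are locally constant around `x₀`, uniformly on compact
sets with respect to the chain `W`. -/
def IsTypeILimitAt (W : ℕ → Set E) (ν : Measure X) (x₀ : X) (f : X → E) : Prop :=
  ∃ γ : ℕ → X → E, (∀ n, IsBorelTypeIAt ν x₀ (γ n)) ∧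
    ∀ K : Set X, IsCompact K → ∀ j, ∀ᶠ n in atTop, ∀ x ∈ K, γ n x - f x ∈ W j

variable {W : ℕ → Set E} {W' : ℕ → Set F} {ν : Measure X} {x₀ : X} {f g : X → E}

theorem IsTypeILimitAt.const (hW : IsAddChain W) (ν : Measure X) (x₀ : X) (a : E) :
    IsTypeILimitAt W ν x₀ fun _ => a :=
  ⟨fun _ _ => a, fun _ => .const ν x₀ a, fun _ _ j => Eventually.of_forall fun _ _ _ =>
    (sub_self a).symm ▸ hW.zero_mem j⟩

theorem IsTypeILimitAt.add [SigmaCompactSpace X] (hW : IsAddChain W)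
    (hf : IsTypeILimitAt W ν x₀ f) (hg : IsTypeILimitAt W ν x₀ g) :
    IsTypeILimitAt W ν x₀ fun x => f x + g x := by
  obtain ⟨γ, hγ, hγ_lim⟩ := hf
  obtain ⟨δ, hδ, hδ_lim⟩ := hg
  refine ⟨fun n x => γ n x + δ n x, fun n => (hγ n).map₂ (hδ n) (· + ·), fun K hK j => ?_⟩
  filter_upwards [hγ_lim K hK (j + 1), hδ_lim K hK (j + 1)] with n hγn hδn x hx
  rw [add_sub_add_comm]
  exact hW.add_mem j _ (hγn x hx) _ (hδn x hx)

theorem IsTypeILimitAt.map (hf : IsTypeILimitAt W ν x₀ f) (q : E →+ F)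
    (hq : ∀ n, ∃ j, ∀ a ∈ W j, q a ∈ W' n) : IsTypeILimitAt W' ν x₀ fun x => q (f x) := by
  obtain ⟨γ, hγ, hγ_lim⟩ := hf
  refine ⟨fun n x => q (γ n x), fun n => (hγ n).map q, fun K hK n => ?_⟩
  obtain ⟨j, hj⟩ := hq n
  filter_upwards [hγ_lim K hK j] with k hk x hx
  exact map_sub q _ _ ▸ hj _ (hk x hx)

theorem IsTypeILimitAt.neg (hW : IsAddChain W) (hf : IsTypeILimitAt W ν x₀ f) :
    IsTypeILimitAt W ν x₀ fun x => -f x :=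
  hf.map (-AddMonoidHom.id E) fun n => ⟨n, hW.neg_mem n⟩

theorem IsTypeILimitAt.neg_one_pow_smul (hW : IsAddChain W) (hf : IsTypeILimitAt W ν x₀ f)
    (k : ℕ) : IsTypeILimitAt W ν x₀ fun x => (-1 : ℤ) ^ k • f x := by
  rcases neg_one_pow_eq_or ℤ k with h | h
  · simpa only [h, one_smul] using hf
  · simpa only [h, neg_smul, one_smul] using hf.neg hW

theorem IsTypeILimitAt.sum [SigmaCompactSpace X] (hW : IsAddChain W) {ι : Type*} (s : Finset ι)
    {f : ι → X → E} (hf : ∀ i, IsTypeILimitAt W ν x₀ (f i)) :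
    IsTypeILimitAt W ν x₀ fun x => ∑ i ∈ s, f i x := by
  classical
  induction s using Finset.induction_on with
  | empty => simpa only [Finset.sum_empty] using IsTypeILimitAt.const hW ν x₀ 0
  | insert a s ha ih => simpa only [Finset.sum_insert ha] using (hf a).add hW ih

theorem IsTypeILimitAt.comp_continuous [TopologicalSpace Y] [MeasurableSpace Y] {ν' : Measure Y}
    {π : X → Y} {f : Y → E} (hf : IsTypeILimitAt W ν' (π x₀) f) (hπ : Continuous π)
    (hπ_qmp : Measure.QuasiMeasurePreserving π ν ν') :
    IsTypeILimitAt W ν x₀ fun x => f (π x) := by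
  obtain ⟨γ, hγ, hγ_lim⟩ := hf
  refine ⟨fun n x => γ n (π x), fun n => (hγ n).comp_continuous hπ hπ_qmp, fun K hK j => ?_⟩
  filter_upwards [hγ_lim (π '' K) (hK.image hπ) j] with n hn x hx
  exact hn _ ⟨x, hx, rfl⟩

theorem IsTypeILimitAt.of_rapid (hW : IsAddChain W) (C : CompactExhaustion X) {γ : ℕ → X → E}
    (hγ : ∀ n, IsBorelTypeIAt ν x₀ (γ n)) (hγf : ∀ n, ∀ x ∈ C n, γ n x - f x ∈ W n) :
    IsTypeILimitAt W ν x₀ f := by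
  refine ⟨γ, hγ, fun K hK j => ?_⟩
  obtain ⟨N, hN⟩ := C.exists_superset_of_isCompact hK
  filter_upwards [eventually_ge_atTop (max N j)] with n hn x hx
  exact hW.antitone ((le_max_right _ _).trans hn)
    (hγf n x (C.subset ((le_max_left _ _).trans hn) (hN hx)))

theorem IsTypeILimitAt.exists_rapid_of_mem (hW : IsAddChain W) {B : AddSubgroup E}
    (hf : IsTypeILimitAt W ν x₀ f) (hfB : ∀ x, f x ∈ B) (C : CompactExhaustion X) (J : ℕ → ℕ) :
    ∃ γ : ℕ → X → E, (∀ n, IsBorelTypeIAt ν x₀ (γ n)) ∧ (∀ n x, γ n x ∈ B) ∧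
      ∀ n, ∀ x ∈ C n, γ n x - f x ∈ W (J n) := by
  obtain ⟨γ, hγ, hγ_lim⟩ := hf
  choose m hm using fun n => (hγ_lim (C n) (C.isCompact n) (J n + 1)).exists
  have exists_round (n : ℕ) (a : E) :
      ∃ b ∈ B, (∃ b' ∈ B, a - b' ∈ W (J n + 1)) → a - b ∈ W (J n + 1) := by
    by_cases h : ∃ b' ∈ B, a - b' ∈ W (J n + 1)
    · exact ⟨h.choose, h.choose_spec.1, fun _ => h.choose_spec.2⟩
    · exact ⟨0, B.zero_mem, fun h' => (h h').elim⟩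
  choose round round_mem round_close using exists_round
  refine ⟨fun n x => round n (γ (m n) x), fun n => (hγ (m n)).map (round n),
    fun n x => round_mem n _, fun n x hx => ?_⟩
  simpa only [sub_sub_sub_cancel_left] using
    hW.sub_mem (hm n x hx) (round_close n _ ⟨f x, hfB x, hm n x hx⟩)

/-- The endomorphisms `ρ g` are equicontinuous over compact sets of parameters `g`, and `ρ g a`
depends continuously on `g`, both with respect to the chain `W`. -/
structure IsContinuousFamily {G : Type*} [TopologicalSpace G] (W : ℕ → Set E) (ρ : G → E →+ E) :
    Prop where
  exists_forall_mem : ∀ K : Set G, IsCompact K → ∀ n, ∃ j, ∀ g ∈ K, ∀ a ∈ W j, ρ g a ∈ W n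
  eventually_sub_mem : ∀ a n g₀, ∀ᶠ g in 𝓝 g₀, ρ g a - ρ g₀ a ∈ W n

theorem IsTypeILimitAt.twist [SigmaCompactSpace X] [WeaklyLocallyCompactSpace X]
    [TopologicalSpace Y] [MeasurableSpace Y] {G : Type*} [TopologicalSpace G] [MeasurableSpace G]
    [TopologicalSpace.MetrizableSpace G] [OpensMeasurableSpace G] {μ : Measure G} [SFinite μ]
    (hW : IsAddChain W) {ρ : G → E →+ E} (hρ : IsContinuousFamily W ρ)
    {ν' : Measure Y} {π : X → Y} {θ : X → G} {f : Y → E} (hf : IsTypeILimitAt W ν' (π x₀) f)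
    (hπ : Continuous π) (hπ_qmp : Measure.QuasiMeasurePreserving π ν ν')
    (hθ : Continuous θ) (hθ_qmp : Measure.QuasiMeasurePreserving θ ν μ) :
    IsTypeILimitAt W ν x₀ fun x => ρ (θ x) (f (π x)) := by
  obtain ⟨γ, hγ, hγ_lim⟩ := hf
  let C : CompactExhaustion X := default
  -- On a compact set `γ n` has finitely many values, so `θ` can be discretised for all of them.
  have exists_discretisation (n : ℕ) : ∃ c : G → G, IsBorelTypeIAt μ (θ x₀) c ∧
      ∀ g ∈ θ '' C n, ∀ a ∈ γ n '' (π '' C n), ρ g a - ρ (c g) a ∈ W n :=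
    exists_isBorelTypeIAt_of_eventually μ (θ x₀)
      (fun g₀ => ⟨g₀, ((hγ n).finite_image ((C.isCompact n).image hπ)).eventually_all.2
        fun a _ => hρ.eventually_sub_mem a n g₀⟩) ((C.isCompact n).image hθ)
  choose c hc hρc using exists_discretisation
  refine ⟨fun n x => ρ (c n (θ x)) (γ n (π x)), fun n =>
    ((hc n).comp_continuous hθ hθ_qmp).map₂ ((hγ n).comp_continuous hπ hπ_qmp) fun g a => ρ g a,
    fun K hK j => ?_⟩
  obtain ⟨N, hN⟩ := C.exists_superset_of_isCompact hK
  obtain ⟨i, hi⟩ := hρ.exists_forall_mem (θ '' K) (hK.image hθ) (j + 1)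
  filter_upwards [eventually_ge_atTop (max N (j + 1)), hγ_lim (π '' K) (hK.image hπ) i]
    with n hn hγn x hx
  have hxC : x ∈ C n := C.subset ((le_max_left _ _).trans hn) (hN hx)
  have move_group : ρ (θ x) (γ n (π x)) - ρ (c n (θ x)) (γ n (π x)) ∈ W (j + 1) :=
    hW.antitone ((le_max_right _ _).trans hn)
      (hρc n (θ x) ⟨x, hxC, rfl⟩ _ ⟨π x, ⟨x, hxC, rfl⟩, rfl⟩)
  have move_value : ρ (θ x) (γ n (π x)) - ρ (θ x) (f (π x)) ∈ W (j + 1) :=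
    map_sub (ρ (θ x)) _ _ ▸ hi (θ x) ⟨x, hx, rfl⟩ _ (hγn _ ⟨x, hx, rfl⟩)
  simpa only [sub_sub_sub_cancel_left] using hW.sub_mem move_value move_group

/-- The lift of the `n`-th term of a sequence `c` through a homomorphism: the partial sum of the
lifts `l i` of the increments of `c`. -/
def telescopeLift (l : ℕ → F → E) (c : ℕ → F) (n : ℕ) : E :=
  l 0 (c 0) + ∑ i ∈ Finset.range n, l i (c (i + 1) - c i)

theorem telescopeLift_succ (l : ℕ → F → E) (c : ℕ → F) (n : ℕ) :
    telescopeLift l c (n + 1) = telescopeLift l c n + l n (c (n + 1) - c n) := by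
  rw [telescopeLift, Finset.sum_range_succ, ← add_assoc, telescopeLift]

theorem map_telescopeLift {q : E →+ F} {B : AddSubgroup F} {l : ℕ → F → E}
    (hl : ∀ n, ∀ b ∈ B, q (l n b) = b) {c : ℕ → F} (hc : ∀ n, c n ∈ B) (n : ℕ) :
    q (telescopeLift l c n) = c n := by
  induction n with
  | zero => rw [telescopeLift, Finset.sum_range_zero, add_zero, hl 0 _ (hc 0)]
  | succ n ih =>
    rw [telescopeLift_succ, map_add, ih, hl n _ (B.sub_mem (hc _) (hc _)), add_sub_cancel]

theorem IsBorelTypeIAt.telescopeLift [SigmaCompactSpace X] (l : ℕ → F → E) {c : ℕ → X → F}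
    (hc : ∀ n, IsBorelTypeIAt ν x₀ (c n)) (n : ℕ) :
    IsBorelTypeIAt ν x₀ fun x => telescopeLift l (c · x) n := by
  induction n with
  | zero =>
    simpa only [MooreCohomology.telescopeLift, Finset.sum_range_zero, add_zero]
      using (hc 0).map (l 0)
  | succ n ih =>
    simpa only [telescopeLift_succ] using
      ih.map₂ ((hc (n + 1)).map₂ (hc n) fun a b => l n (a - b)) (· + ·)

theorem IsCompleteChain.exists_telescopeLift (hW : IsCompleteChain W) {l : ℕ → F → E} {c : ℕ → F}
    {N : ℕ} (hlc : ∀ n, N ≤ n → l n (c (n + 1) - c n) ∈ W n) :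
    ∃ s, ∀ n, N ≤ n → telescopeLift l c (n + 3) - s ∈ W n := by
  obtain ⟨s, hs⟩ := hW (fun n => l n (c (n + 1) - c n)) N hlc
  refine ⟨l 0 (c 0) + s, fun n hn => ?_⟩
  rw [telescopeLift, add_sub_add_left_eq_sub]
  exact hs n hn

theorem exists_monotone_ge (j : ℕ → ℕ) : ∃ J : ℕ → ℕ, Monotone J ∧ ∀ n, n ≤ J n ∧ j n ≤ J n :=
  ⟨fun n => n + partialSups j n,
    fun _ _ hmn => Nat.add_le_add hmn ((partialSups j).mono hmn),
    fun n => ⟨Nat.le_add_right _ _, (le_partialSups j n).trans (Nat.le_add_left _ _)⟩⟩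

/-- `q` maps onto the subgroup `B`, is open as a map to `B`, and has closed graph, with respect to
the chains `W` and `W'`. -/
structure IsStrictOnto (W : ℕ → Set E) (W' : ℕ → Set F) (q : E →+ F) (B : AddSubgroup F) :
    Prop where
  exists_lift : ∀ n, ∃ j, ∀ b ∈ B, ∃ a, q a = b ∧ (b ∈ W' j → a ∈ W n)
  map_eq_of_eventually : ∀ (e : ℕ → E) (s : E) (b : F), (∀ᶠ n in atTop, e n - s ∈ W n) →
    (∀ᶠ n in atTop, q (e n) - b ∈ W' n) → q s = b

theorem IsTypeILimitAt.exists_lift [SigmaCompactSpace X] [WeaklyLocallyCompactSpace X]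
    (hW : IsAddChain W) (hW_complete : IsCompleteChain W) (hW' : IsAddChain W') {q : E →+ F}
    {B : AddSubgroup F} (hq : IsStrictOnto W W' q B) {b : X → F} (hb : IsTypeILimitAt W' ν x₀ b)
    (hbB : ∀ x, b x ∈ B) : ∃ u : X → E, IsTypeILimitAt W ν x₀ u ∧ ∀ x, q (u x) = b x := by
  let C : CompactExhaustion X := default
  choose! j l hl using hq.exists_lift
  obtain ⟨J, hJ_mono, hJ⟩ := exists_monotone_ge j
  obtain ⟨c, hc, hcB, hcb⟩ := hb.exists_rapid_of_mem hW' hbB C fun n => J n + 1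
  have increment_mem (n : ℕ) (x : X) (hx : x ∈ C n) : c (n + 1) x - c n x ∈ W' (j n) := by
    have next_close : c (n + 1) x - b x ∈ W' (J n + 1) :=
      hW'.antitone (Nat.add_le_add_right (hJ_mono n.le_succ) 1)
        (hcb (n + 1) x (C.subset n.le_succ hx))
    simpa only [sub_sub_sub_cancel_right] using
      hW'.antitone (hJ n).2 (hW'.sub_mem next_close (hcb n x hx))
  have exists_limit (x : X) :
      ∃ s, ∀ n, x ∈ C n → telescopeLift l (c · x) (n + 3) - s ∈ W n := by
    obtain ⟨s, hs⟩ := hW_complete.exists_telescopeLift (l := l) (c := (c · x)) (N := C.find x)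
      fun n hn => (hl n _ (B.sub_mem (hcB _ _) (hcB _ _))).2
        (increment_mem n x (C.mem_iff_find_le.2 hn))
    exact ⟨s, fun n hn => hs n (C.mem_iff_find_le.1 hn)⟩
  choose u hu using exists_limit
  refine ⟨u, .of_rapid hW C (fun n => .telescopeLift l hc (n + 3)) fun n x => hu x n, fun x => ?_⟩
  have eventually_mem : ∀ᶠ n in atTop, x ∈ C n :=
    (eventually_ge_atTop (C.find x)).mono fun n hn => C.mem_iff_find_le.2 hn
  refine hq.map_eq_of_eventually (fun n => telescopeLift l (c · x) (n + 3)) _ _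
    (eventually_mem.mono fun n hn => hu x n hn) (eventually_mem.mono fun n hn => ?_)
  rw [map_telescopeLift (fun n b hb => (hl n b hb).1) (hcB · x)]
  exact hW'.antitone (by have := (hJ (n + 3)).1; omega)
    (hcb (n + 3) x (C.subset (Nat.le_add_right n 3) hn))

end TypeILimit

section SmallInMeasure

theorem inv_two_pow_succ_add_self (n : ℕ) : (2⁻¹ : ℝ≥0∞) ^ (n + 1) + 2⁻¹ ^ (n + 1) = 2⁻¹ ^ n := by
  rw [pow_succ, ← mul_add, ENNReal.inv_two_add_inv_two, mul_one]

theorem tsum_inv_two_pow_add (n : ℕ) : ∑' k : ℕ, (2⁻¹ : ℝ≥0∞) ^ (k + (n + 1)) = 2⁻¹ ^ n := by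
  simp_rw [pow_add _ _ (n + 1)]
  rw [ENNReal.tsum_mul_right, ENNReal.tsum_geometric, ENNReal.one_sub_inv_two, inv_inv, pow_succ',
    ← mul_assoc, ENNReal.mul_inv_cancel two_ne_zero ENNReal.ofNat_ne_top, one_mul]

theorem IsNhdsChain.sum_sub_mem_of_tendsto {A : Type*} [AddCommGroup A] [TopologicalSpace A]
    [IsTopologicalAddGroup A] {V : ℕ → Set A} (hV : IsNhdsChain V) {a : ℕ → A} {s : A} {n : ℕ}
    (hs : Tendsto (fun k => ∑ i ∈ Finset.range k, a i) atTop (𝓝 s))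
    (ha : ∀ k, n + 3 ≤ k → a k ∈ V k) : ∑ i ∈ Finset.range (n + 3), a i - s ∈ V n := by
  rw [← neg_sub]
  refine hV.neg_mem n _ (hV.mem_of_tendsto (hs.sub_const _) ?_)
  filter_upwards [eventually_ge_atTop (n + 3)] with M hM
  rw [← Finset.sum_Ico_eq_sub _ hM]
  exact hV.antitone (Nat.le_succ (n + 1)) (hV.sum_Ico_mem (n + 2) M fun k hk _ => ha k hk)

theorem coeFn_finsetSum {X A ι : Type*} [MeasurableSpace X] {ν : Measure X} [AddCommGroup A]
    [TopologicalSpace A] [IsTopologicalAddGroup A] (s : Finset ι) (a : ι → X →ₘ[ν] A) :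
    ⇑(∑ i ∈ s, a i) =ᵐ[ν] fun y => ∑ i ∈ s, a i y := by
  classical
  induction s using Finset.induction_on with
  | empty =>
    simp only [Finset.sum_empty]
    exact AEEqFun.coeFn_zero
  | insert i s hi ih =>
    simp only [Finset.sum_insert hi]
    exact (AEEqFun.coeFn_add _ _).trans (EventuallyEq.rfl.add ih)

variable {X : Type*} [TopologicalSpace X] [MeasurableSpace X] {A : Type*} [TopologicalSpace A]

/-- The classes that take values in `V n` on the `n`-th compact set of the exhaustion `K`, up to a
set of measure at most `2⁻ⁿ`. If `V` is a neighbourhood basis of zero, these sets define the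
topology of convergence in measure on compact sets. -/
def smallInMeasure (ν : Measure X) (K : CompactExhaustion X) (V : ℕ → Set A) (n : ℕ) :
    Set (X →ₘ[ν] A) :=
  {φ | ν {y | y ∈ K n ∧ φ y ∉ V n} ≤ 2⁻¹ ^ n}

variable {ν : Measure X} {K : CompactExhaustion X} {V : ℕ → Set A}

theorem mem_smallInMeasure_of_ae {n : ℕ} {φ : X →ₘ[ν] A} {E : Set X} (hE : ν E ≤ 2⁻¹ ^ n)
    (h : ∀ᵐ y ∂ν, y ∈ K n → y ∉ E → φ y ∈ V n) : φ ∈ smallInMeasure ν K V n := by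
  refine (measure_mono_ae ?_).trans hE
  filter_upwards [h] with y hy ⟨hyK, hyV⟩
  exact of_not_not fun hyE => hyV (hy hyK hyE)

theorem ae_eventually_mem_of_mem_smallInMeasure {a : ℕ → X →ₘ[ν] A}
    (ha : ∀ᶠ n in atTop, a n ∈ smallInMeasure ν K V n) :
    ∀ᵐ y ∂ν, ∀ᶠ n in atTop, a n y ∈ V n := by
  obtain ⟨N, hN⟩ := eventually_atTop.1 ha
  have measure_bad_le (n : ℕ) : ν {y | N ≤ n ∧ y ∈ K n ∧ a n y ∉ V n} ≤ 2⁻¹ ^ n := by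
    by_cases hn : N ≤ n
    · simp only [hn, true_and]
      exact hN n hn
    · simp only [hn, false_and, Set.ofPred_false, measure_empty, zero_le]
  have tsum_ne_top : ∑' n, ν {y | N ≤ n ∧ y ∈ K n ∧ a n y ∉ V n} ≠ ∞ := by
    refine ne_top_of_le_ne_top ?_ (ENNReal.tsum_le_tsum measure_bad_le)
    rw [ENNReal.tsum_geometric, ENNReal.one_sub_inv_two, inv_inv]
    exact ENNReal.ofNat_ne_top
  filter_upwards [ae_eventually_notMem tsum_ne_top] with y hy
  filter_upwards [hy, eventually_ge_atTop N, eventually_ge_atTop (K.find y)] with n hn hNn hKn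
  exact of_not_not fun hyV => hn ⟨hNn, K.mem_iff_find_le.2 hKn, hyV⟩

variable [AddCommGroup A] [IsTopologicalAddGroup A]

theorem IsAddChain.smallInMeasure (hV : IsAddChain V) : IsAddChain (smallInMeasure ν K V) where
  zero_mem n := mem_smallInMeasure_of_ae (E := ∅) (measure_empty.trans_le zero_le) (by
    filter_upwards [AEEqFun.coeFn_zero (μ := ν) (α := X) (β := A)] with y hy _ _
    exact hy ▸ hV.zero_mem n)
  neg_mem n φ hφ := mem_smallInMeasure_of_ae hφ (by
    filter_upwards [AEEqFun.coeFn_neg φ] with y hy hyK hyE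
    exact hy ▸ hV.neg_mem n _ (of_not_not fun hyV => hyE ⟨hyK, hyV⟩))
  add_mem n φ hφ ψ hψ := by
    refine mem_smallInMeasure_of_ae (E := _ ∪ _) ((measure_union_le _ _).trans
      ((add_le_add hφ hψ).trans_eq (inv_two_pow_succ_add_self n))) ?_
    filter_upwards [AEEqFun.coeFn_add φ ψ] with y hy hyK hyE
    have hyK' : y ∈ K (n + 1) := K.subset n.le_succ hyK
    exact hy ▸ hV.add_mem n _ (of_not_not fun hyV => hyE (.inl ⟨hyK', hyV⟩)) _
      (of_not_not fun hyV => hyE (.inr ⟨hyK', hyV⟩))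

theorem ae_tendsto_of_sub_mem_smallInMeasure (hV : IsNhdsChain V) {e : ℕ → X →ₘ[ν] A}
    {s : X →ₘ[ν] A} (h : ∀ᶠ n in atTop, e n - s ∈ smallInMeasure ν K V n) :
    ∀ᵐ y ∂ν, Tendsto (fun n => e n y) atTop (𝓝 (s y)) := by
  have sub_apply : ∀ᵐ y ∂ν, ∀ n, (e n - s) y = e n y - s y :=
    ae_all_iff.2 fun n => AEEqFun.coeFn_sub _ _
  filter_upwards [ae_eventually_mem_of_mem_smallInMeasure h, sub_apply] with y hy hy_sub
  refine hV.tendsto_iff.2 fun k => ?_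
  filter_upwards [hy, eventually_ge_atTop k] with n hn hkn
  exact hy_sub n ▸ hV.antitone hkn hn

theorem isCompleteChain_smallInMeasure [TopologicalSpace.IsCompletelyMetrizableSpace A]
    (hV : IsNhdsChain V) : IsCompleteChain (smallInMeasure ν K V) := by
  intro a N ha
  have ae_summable : ∀ᵐ y ∂ν, ∃ b, Tendsto (fun n => ∑ i ∈ Finset.range n, a i y) atTop (𝓝 b) := by
    filter_upwards [ae_eventually_mem_of_mem_smallInMeasure (eventually_atTop.2 ⟨N, ha⟩)] with y hy
    obtain ⟨M, hM⟩ := eventually_atTop.1 hy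
    exact hV.exists_tendsto_sum hM
  obtain ⟨f, hf, hf_lim⟩ := exists_stronglyMeasurable_limit_of_tendsto_ae
    (fun n => Finset.aestronglyMeasurable_fun_sum (Finset.range n)
      fun i _ => (a i).aestronglyMeasurable) ae_summable
  refine ⟨AEEqFun.mk f hf.aestronglyMeasurable, fun n hn => mem_smallInMeasure_of_ae
    (E := ⋃ k : ℕ, {y | y ∈ K (k + (n + 1)) ∧ a (k + (n + 1)) y ∉ V (k + (n + 1))})
    ((measure_iUnion_le _).trans ((ENNReal.tsum_le_tsum fun k => ha _ (by omega)).trans_eq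
      (tsum_inv_two_pow_add n))) ?_⟩
  filter_upwards [AEEqFun.coeFn_sub (∑ i ∈ Finset.range (n + 3), a i)
    (AEEqFun.mk f hf.aestronglyMeasurable), AEEqFun.coeFn_mk f hf.aestronglyMeasurable,
    coeFn_finsetSum (Finset.range (n + 3)) a, hf_lim] with y hy_sub hy_mk hy_sum hy_lim hyK hyE
  rw [hy_sub, Pi.sub_apply, hy_mk, hy_sum]
  refine hV.sum_sub_mem_of_tendsto hy_lim fun k hk => of_not_not fun hyV => hyE ?_
  obtain ⟨i, rfl⟩ : ∃ i, k = i + (n + 1) := ⟨k - (n + 1), by omega⟩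
  exact Set.mem_iUnion.2 ⟨i, K.subset (by omega) hyK, hyV⟩

end SmallInMeasure

section Slice

theorem exists_mem_measure_slice_le {X Y : Type*} [MeasurableSpace X] [MeasurableSpace Y]
    {μ : Measure X} {ν : Measure Y} [SFinite ν] {Z : Set (X × Y)} {C : Set X} {a b : ℝ≥0∞}
    (hb_ne_zero : b ≠ 0) (hb_ne_top : b ≠ ∞) (ha : a < μ C) (hZ : μ.prod ν Z ≤ a * b)
    {P : X → Prop} (hP : ∀ᵐ x ∂μ, P x) : ∃ x ∈ C, P x ∧ ν {y | (x, y) ∈ Z} ≤ b := by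
  let Z' := toMeasurable (μ.prod ν) Z
  have hZ' : MeasurableSet Z' := measurableSet_toMeasurable _ _
  let slice (x : X) : ℝ≥0∞ := ν (Prod.mk x ⁻¹' Z')
  have measurable_slice : Measurable slice := measurable_measure_prodMk_left hZ'
  have measure_large_slices : μ {x | b ≤ slice x} < μ C :=
    calc μ {x | b ≤ slice x} ≤ (∫⁻ x, slice x ∂μ) / b :=
          meas_ge_le_lintegral_div measurable_slice.aemeasurable hb_ne_zero hb_ne_top
      _ = μ.prod ν Z / b := by rw [← measure_toMeasurable Z, Measure.prod_apply hZ']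
      _ ≤ a := ENNReal.div_le_of_le_mul hZ
      _ < μ C := ha
  by_contra! h
  refine measure_large_slices.not_ge (measure_mono_ae ?_)
  filter_upwards [hP] with x hx hxC
  exact (h x hxC hx).le.trans (measure_mono fun y hy => subset_toMeasurable _ _ hy)

theorem dFun_snoc {G A : Type*} [AddCommGroup A] {m : ℕ} (f : (Fin (m + 1) → G) → A) (t : G)
    (y : Fin (m + 1) → G) : dFun f (Fin.snoc (α := fun _ => G) y t) =
      f y - dFun (fun z => f (Fin.snoc (α := fun _ => G) z t)) y := by
  have removeNth_castSucc_snoc (i : Fin (m + 1)) :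
      i.castSucc.removeNth (Fin.snoc (α := fun _ => G) y t) =
        Fin.snoc (α := fun _ => G) (i.removeNth y) t := by
    ext k
    induction k using Fin.lastCases with
    | last =>
      rw [Fin.removeNth_apply, Fin.succAbove_ne_last_last (Fin.castSucc_lt_last i).ne,
        Fin.snoc_last, Fin.snoc_last]
    | cast k =>
      rw [Fin.removeNth_apply, Fin.castSucc_succAbove_castSucc, Fin.snoc_castSucc,
        Fin.snoc_castSucc, Fin.removeNth_apply]
  rw [dFun, Fin.sum_univ_castSucc, add_comm, sub_eq_add_neg, dFun, ← Finset.sum_neg_distrib]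
  congr 1
  · rw [Fin.val_last, Nat.sub_self, pow_zero, one_smul, Fin.removeNth_last, Fin.init_snoc]
  · refine Finset.sum_congr rfl fun i _ => ?_
    rw [Fin.val_castSucc, show m + 1 - (i : ℕ) = m - i + 1 by omega, removeNth_castSucc_snoc,
      pow_succ, mul_neg_one, neg_smul]

theorem measurePreserving_snoc {G : Type*} [MeasurableSpace G] (μ : Measure G) [SigmaFinite μ]
    (m : ℕ) : MeasurePreserving (fun p : G × (Fin m → G) => Fin.snoc (α := fun _ => G) p.2 p.1)
      (μ.prod (powMeasure μ m)) (powMeasure μ (m + 1)) := by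
  convert (measurePreserving_piFinSuccAbove (fun _ => μ) (Fin.last m)).symm using 1
  exact funext fun p => (Fin.insertNth_last' p.1 p.2).symm

/-- The exhaustion of `G^m` by the powers of the sets of an exhaustion of `G`. -/
def powExhaustion {G : Type*} [TopologicalSpace G] (C : CompactExhaustion G) (m : ℕ) :
    CompactExhaustion (Fin m → G) where
  toFun n := Set.univ.pi fun _ => C n
  isCompact' n := isCompact_univ_pi fun _ => C.isCompact n
  subset_interior_succ' n := by
    rw [interior_pi_set Set.finite_univ]
    exact Set.pi_mono fun _ _ => C.subset_interior_succ n
  iUnion_eq' := Set.eq_univ_of_forall fun y => by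
    obtain ⟨N, hN⟩ : ∃ N, ∀ i, y i ∈ C N :=
      ⟨Finset.univ.sup fun i => C.find (y i), fun i =>
        C.mem_iff_find_le.2 (Finset.le_sup (f := fun i => C.find (y i)) (Finset.mem_univ i))⟩
    exact Set.mem_iUnion.2 ⟨N, fun i _ => hN i⟩

theorem snoc_mem_powExhaustion {G : Type*} [TopologicalSpace G] {C : CompactExhaustion G}
    {m n : ℕ} {y : Fin m → G} {t : G} (hy : y ∈ powExhaustion C m n) (ht : t ∈ C n) :
    Fin.snoc (α := fun _ => G) y t ∈ powExhaustion C (m + 1) n := fun i _ => by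
  induction i using Fin.lastCases with
  | last => exact (Fin.snoc_last (α := fun _ => G) t y).symm ▸ ht
  | cast i => exact (Fin.snoc_castSucc (α := fun _ => G) t y i).symm ▸ hy i trivial

variable {G : Type*} [MeasurableSpace G] {μ : Measure G} [SigmaFinite μ] {A : Type*}
  [TopologicalSpace A]

/-- The class of a cochain with its last variable frozen at `t`. It is meaningful only for almost
every `t`. -/
noncomputable def sliceLast {m : ℕ} (φ : Cochain μ A (m + 1)) (t : G) : Cochain μ A m :=
  AEEqFun.mk (fun y => φ (Fin.snoc (α := fun _ => G) y t))
    (φ.stronglyMeasurable.comp_measurable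
      ((measurePreserving_snoc μ m).measurable.comp measurable_prodMk_left)).aestronglyMeasurable

theorem coeFn_sliceLast {m : ℕ} (φ : Cochain μ A (m + 1)) (t : G) :
    sliceLast φ t =ᵐ[powMeasure μ m] fun y => φ (Fin.snoc (α := fun _ => G) y t) :=
  AEEqFun.coeFn_mk _ _

theorem exists_sliceLast_mem [TopologicalSpace G] [NeZero μ] (C : CompactExhaustion G)
    {V : ℕ → Set A} (hV : Antitone V) (m n : ℕ) : ∃ j, ∀ φ : Cochain μ A (m + 1),
      φ ∈ smallInMeasure (powMeasure μ (m + 1)) (powExhaustion C (m + 1)) V j →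
        ∀ P : G → Prop, (∀ᵐ t ∂μ, P t) →
          ∃ t, P t ∧ sliceLast φ t ∈ smallInMeasure (powMeasure μ m) (powExhaustion C m) V n := by
  obtain ⟨k, hk⟩ : ∃ k, μ (C k) ≠ 0 := by
    by_contra! h
    have measure_univ : μ Set.univ = 0 := C.iUnion_eq ▸ measure_iUnion_null h
    exact NeZero.ne μ (Measure.measure_univ_eq_zero.1 measure_univ)
  obtain ⟨l, hl⟩ := ENNReal.exists_inv_two_pow_lt hk
  refine ⟨l + n + k, fun φ hφ P hP => ?_⟩
  let Z := {z | z ∈ powExhaustion C (m + 1) (l + n + k) ∧ φ z ∉ V (l + n + k)}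
  have measure_Z : μ.prod (powMeasure μ m)
      ((fun p : G × (Fin m → G) => Fin.snoc (α := fun _ => G) p.2 p.1) ⁻¹' Z) ≤
        2⁻¹ ^ l * 2⁻¹ ^ n :=
    calc _ ≤ powMeasure μ (m + 1) Z := (measurePreserving_snoc μ m).measure_preimage_le Z
      _ ≤ 2⁻¹ ^ (l + n + k) := hφ
      _ ≤ 2⁻¹ ^ (l + n) := pow_le_pow_right_of_le_one' (ENNReal.inv_le_one.2 one_le_two) (by omega)
      _ = _ := pow_add _ _ _
  obtain ⟨t, htC, htP, htZ⟩ := exists_mem_measure_slice_le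
    (pow_ne_zero n (ENNReal.inv_ne_zero.2 ENNReal.ofNat_ne_top))
    (ENNReal.pow_ne_top (ENNReal.inv_ne_top.2 two_ne_zero)) hl measure_Z hP
  refine ⟨t, htP, mem_smallInMeasure_of_ae htZ ?_⟩
  filter_upwards [coeFn_sliceLast φ t] with y hy hyC hyZ
  exact hy ▸ of_not_not fun hyV => hyZ ⟨snoc_mem_powExhaustion
    ((powExhaustion C m).subset (by omega) hyC) (C.subset (by omega) htC),
    fun h => hyV (hV (by omega) h)⟩

end Slice

section DifferentialStrict

variable {G : Type*} [Group G] [TopologicalSpace G] [IsTopologicalGroup G]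
  [LocallyCompactSpace G] [SecondCountableTopology G] [MeasurableSpace G] [BorelSpace G]
  {μ : Measure G} [μ.IsHaarMeasure] {A : Type*} [AddCommGroup A] [TopologicalSpace A]
  [IsTopologicalAddGroup A] {V : ℕ → Set A}

theorem ae_d_sliceLast {m : ℕ} {φ : Cochain μ A (m + 1)} (hφ : d μ A (m + 1) φ = 0) :
    ∀ᵐ t ∂μ, d μ A m (sliceLast φ t) = φ := by
  have dFun_eq_zero : ∀ᵐ z ∂powMeasure μ (m + 2), dFun φ z = 0 := by
    filter_upwards [coeFn_d μ A φ, hφ ▸ AEEqFun.coeFn_zero] with z hz hz_zero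
    exact hz.symm.trans hz_zero
  filter_upwards [Measure.ae_ae_of_ae_prod
    ((measurePreserving_snoc μ (m + 1)).quasiMeasurePreserving.ae dFun_eq_zero)] with t ht
  refine AEEqFun.ext ((coeFn_d μ A _).trans ((dFun_congr μ A (coeFn_sliceLast φ t)).trans ?_))
  filter_upwards [ht] with y hy
  exact (sub_eq_zero.1 (dFun_snoc φ t y ▸ hy)).symm

theorem d_eq_of_eventually_mem_smallInMeasure [T2Space A] (hV : IsNhdsChain V) {m : ℕ}
    {K : CompactExhaustion (Fin m → G)} {K' : CompactExhaustion (Fin (m + 1) → G)}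
    {e : ℕ → Cochain μ A m} {s : Cochain μ A m} {b : Cochain μ A (m + 1)}
    (hs : ∀ᶠ n in atTop, e n - s ∈ smallInMeasure (powMeasure μ m) K V n)
    (hb : ∀ᶠ n in atTop, d μ A m (e n) - b ∈ smallInMeasure (powMeasure μ (m + 1)) K' V n) :
    d μ A m s = b := by
  have tendsto_faces : ∀ᵐ y ∂powMeasure μ (m + 1), ∀ i : Fin (m + 1),
      Tendsto (fun n => e n (i.removeNth y)) atTop (𝓝 (s (i.removeNth y))) :=
    ae_all_iff.2 fun i => (quasiMeasurePreserving_removeNth μ i).ae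
      (ae_tendsto_of_sub_mem_smallInMeasure hV hs)
  have d_apply : ∀ᵐ y ∂powMeasure μ (m + 1), ∀ n, d μ A m (e n) y = dFun (e n) y :=
    ae_all_iff.2 fun n => coeFn_d μ A _
  refine AEEqFun.ext ?_
  filter_upwards [tendsto_faces, d_apply, ae_tendsto_of_sub_mem_smallInMeasure hV hb,
    coeFn_d μ A s] with y hy_faces hy_d hy_lim hy_s
  rw [hy_s]
  refine tendsto_nhds_unique ?_ hy_lim
  simp only [hy_d]
  exact tendsto_finsetSum _ fun i _ => (hy_faces i).const_smul _

theorem isStrictOnto_d [T2Space A] (hV : IsNhdsChain V) (C : CompactExhaustion G) (m : ℕ) :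
    IsStrictOnto (smallInMeasure (powMeasure μ m) (powExhaustion C m) V)
      (smallInMeasure (powMeasure μ (m + 1)) (powExhaustion C (m + 1)) V) (d μ A m)
      (d μ A (m + 1)).ker where
  exists_lift n := by
    obtain ⟨j, hj⟩ := exists_sliceLast_mem (μ := μ) C hV.antitone m n
    refine ⟨j, fun φ hφ => ?_⟩
    by_cases hφj : φ ∈ smallInMeasure (powMeasure μ (m + 1)) (powExhaustion C (m + 1)) V j
    · obtain ⟨t, ht, ht_mem⟩ := hj φ hφj _ (ae_d_sliceLast hφ)
      exact ⟨sliceLast φ t, ht, fun _ => ht_mem⟩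
    · obtain ⟨t, ht⟩ := (ae_d_sliceLast hφ).exists
      exact ⟨sliceLast φ t, ht, fun h => (hφj h).elim⟩
  map_eq_of_eventually _ _ _ := d_eq_of_eventually_mem_smallInMeasure hV

end DifferentialStrict

section JointRepresentative

/-- `U` is a jointly measurable choice of representatives for the classes `u x`. -/
structure IsJointRepresentative {X Y : Type*} [MeasurableSpace X] [MeasurableSpace Y] {A : Type*}
    [TopologicalSpace A] {ν : Measure Y} (U : X × Y → A) (u : X → Y →ₘ[ν] A) : Prop where
  stronglyMeasurable : StronglyMeasurable U
  ae_eq : ∀ x, (fun y => U (x, y)) =ᵐ[ν] u x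

theorem IsTypeILimitAt.exists_isJointRepresentative {X Y : Type*} [TopologicalSpace X]
    [MeasurableSpace X] [SigmaCompactSpace X] [WeaklyLocallyCompactSpace X] [TopologicalSpace Y]
    [MeasurableSpace Y] {A : Type*} [AddCommGroup A] [TopologicalSpace A]
    [IsTopologicalAddGroup A] [PolishSpace A] {V : ℕ → Set A} (hV : IsNhdsChain V)
    {ν : Measure X} {x₀ : X} {ν' : Measure Y} {K : CompactExhaustion Y} {u : X → Y →ₘ[ν'] A}
    (hu : IsTypeILimitAt (smallInMeasure ν' K V) ν x₀ u) :
    ∃ U : X × Y → A, IsJointRepresentative U u := by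
  borelize A
  let C : CompactExhaustion X := default
  obtain ⟨γ, hγ, -, hγ_close⟩ := hu.exists_rapid_of_mem (B := ⊤) hV.smallInMeasure
    (fun _ => trivial) C id
  have stronglyMeasurable_approx (n : ℕ) : StronglyMeasurable fun z : X × Y => γ n z.1 z.2 := by
    refine Measurable.stronglyMeasurable fun s hs => ?_
    have preimage_eq : (fun z : X × Y => γ n z.1 z.2) ⁻¹' s =
        ⋃ a ∈ Set.range (γ n), (γ n ⁻¹' {a}) ×ˢ (a ⁻¹' s) := by
      ext z
      simp only [Set.mem_preimage, Set.mem_iUnion, Set.mem_prod, Set.mem_singleton_iff]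
      exact ⟨fun hz => ⟨γ n z.1, ⟨_, rfl⟩, rfl, hz⟩, fun ⟨_, _, ha, hz⟩ => ha ▸ hz⟩
    rw [preimage_eq]
    exact .biUnion (hγ n).countable_range fun a _ =>
      ((hγ n).measurableSet_preimage _).prod (a.stronglyMeasurable.measurable hs)
  refine ⟨fun z => limUnder atTop fun n => γ n z.1 z.2,
    StronglyMeasurable.limUnder stronglyMeasurable_approx, fun x => ?_⟩
  have eventually_close : ∀ᶠ n in atTop, γ n x - u x ∈ smallInMeasure ν' K V n :=
    (eventually_ge_atTop (C.find x)).mono fun n hn => hγ_close n x (C.mem_iff_find_le.2 hn)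
  filter_upwards [ae_tendsto_of_sub_mem_smallInMeasure hV eventually_close] with y hy
  exact hy.limUnder_eq

end JointRepresentative

section NoVariables

variable {G : Type*} [MeasurableSpace G] {μ : Measure G}

theorem powMeasure_zero : powMeasure μ 0 = Measure.dirac default :=
  Measure.pi_of_empty _ default

theorem forall_of_ae_powMeasure_zero {P : (Fin 0 → G) → Prop} (h : ∀ᵐ y ∂powMeasure μ 0, P y)
    (y : Fin 0 → G) : P y := by
  rw [powMeasure_zero] at h
  obtain ⟨z, hz⟩ := h.exists
  exact Subsingleton.elim z y ▸ hz

variable {A : Type*} [AddCommGroup A] [TopologicalSpace A] [IsTopologicalAddGroup A]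

variable (μ A) in
/-- The value of a cochain of no variables. -/
noncomputable def evalZero : Cochain μ A 0 →+ A :=
  AddMonoidHom.mk' (fun φ => φ default) fun φ ψ =>
    forall_of_ae_powMeasure_zero (AEEqFun.coeFn_add φ ψ) default

theorem evalZero_mem [TopologicalSpace G] {C : CompactExhaustion G} {V : ℕ → Set A} {n : ℕ}
    {φ : Cochain μ A 0} (h : φ ∈ smallInMeasure (powMeasure μ 0) (powExhaustion C 0) V (n + 1)) :
    evalZero μ A φ ∈ V (n + 1) := by
  by_contra hφ
  have bad_eq_univ : {y | y ∈ powExhaustion C 0 (n + 1) ∧ φ y ∉ V (n + 1)} = Set.univ :=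
    Set.eq_univ_of_forall fun y => ⟨fun i _ => i.elim0, Subsingleton.elim default y ▸ hφ⟩
  rw [smallInMeasure, Set.mem_ofPred_eq] at h
  refine h.not_gt ?_
  rw [bad_eq_univ, powMeasure_zero, measure_univ]
  exact pow_lt_one₀ zero_le (ENNReal.inv_lt_one.2 ENNReal.one_lt_two) n.succ_ne_zero

end NoVariables

section Evaluation
variable {G : Type*} [Group G] [TopologicalSpace G] [IsTopologicalGroup G]
  [LocallyCompactSpace G] [SecondCountableTopology G] [MeasurableSpace G] [BorelSpace G]
  {μ : Measure G} [μ.IsHaarMeasure] {A : Type*} [AddCommGroup A] [TopologicalSpace A]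
  [IsTopologicalAddGroup A]

theorem evalZero_eq_zero_of_d_eq_zero {φ : Cochain μ A 0} (h : d μ A 0 φ = 0) :
    evalZero μ A φ = 0 := by
  obtain ⟨x, hx, hx_zero⟩ := ((coeFn_d μ A φ).and (h ▸ AEEqFun.coeFn_zero)).exists
  have dFun_eq : dFun φ x = evalZero μ A φ := by
    rw [dFun, Fin.sum_univ_one, Fin.val_zero, Nat.sub_zero, pow_zero, one_smul,
      Subsingleton.elim (Fin.removeNth 0 x) default]
    rfl
  exact dFun_eq.symm.trans (hx.symm.trans hx_zero)

theorem evalZero_diagAct [DistribMulAction G A] [ContinuousSMul G A] (g : G)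
    (φ : Cochain μ A 0) : evalZero μ A (diagAct μ g φ) = g • evalZero μ A φ :=
  (forall_of_ae_powMeasure_zero (coeFn_diagAct μ A g φ) default).trans
    (congrArg (g • φ ·) (Subsingleton.elim _ _))

end Evaluation

section ActionContinuity

theorem exists_finset_measure_sdiff_biUnion_le {X A : Type*} [MeasurableSpace X]
    {ν : Measure X} [AddCommGroup A] [TopologicalSpace A] [IsTopologicalAddGroup A]
    [TopologicalSpace.SeparableSpace A] [TopologicalSpace.PseudoMetrizableSpace A] {U : Set A}
    (hU : IsOpen U) (hU_zero : 0 ∈ U) {f : X → A} (hf : StronglyMeasurable f) {D : Set X}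
    (hD : MeasurableSet D) (hD_top : ν D ≠ ∞) {ε : ℝ≥0∞} (hε : 0 < ε) :
    ∃ s : Finset A, ν (D \ ⋃ b ∈ s, {y | f y - b ∈ U}) ≤ ε := by
  borelize A
  let b : ℕ → A := TopologicalSpace.denseSeq A
  let R (M : ℕ) : Set X := D \ ⋃ i ∈ Finset.range M, {y | f y - b i ∈ U}
  have measurableSet_R (M : ℕ) : MeasurableSet (R M) :=
    hD.diff (.biUnion (Finset.countable_toSet _) fun i _ =>
      (hf.sub stronglyMeasurable_const).measurable hU.measurableSet)
  have antitone_R : Antitone R := fun M N hMN => Set.sdiff_subset_sdiff_right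
    (Set.biUnion_subset_biUnion_left (Finset.range_mono hMN))
  have iInter_R : ⋂ M, R M = ∅ := by
    refine Set.eq_empty_iff_forall_notMem.2 fun y hy => ?_
    obtain ⟨i, hi⟩ := (TopologicalSpace.denseRange_denseSeq A).exists_mem_open
      (hU.preimage (continuous_const.sub continuous_id))
      ⟨f y, show f y - f y ∈ U from (sub_self (f y)).symm ▸ hU_zero⟩
    exact (Set.mem_iInter.1 hy (i + 1)).2
      (Set.mem_biUnion (x := i) (Finset.mem_coe.2 (Finset.self_mem_range_succ i)) hi)
  have measure_R : Tendsto (fun M => ν (R M)) atTop (𝓝 0) := by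
    rw [← measure_empty (μ := ν), ← iInter_R]
    exact tendsto_measure_iInter_atTop (fun M => (measurableSet_R M).nullMeasurableSet) antitone_R
      ⟨0, measure_ne_top_of_subset Set.sdiff_subset hD_top⟩
  obtain ⟨M, hM⟩ := (ENNReal.tendsto_nhds_zero.1 measure_R ε hε).exists
  classical
  refine ⟨(Finset.range M).image b, ?_⟩
  rwa [Finset.set_biUnion_finset_image]

theorem IsAddChain.smul_sub_mem {G A : Type*} [Monoid G] [AddCommGroup A] [DistribMulAction G A]
    {V : ℕ → Set A} (hV : IsAddChain V) {g : G} {a b c : A} {n : ℕ}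
    (ha : g • (a - b) ∈ V (n + 1)) (hb : g • b - b ∈ V (n + 2)) (hc : c - b ∈ V (n + 2)) :
    g • a - c ∈ V n := by
  convert hV.add_mem n _ ha _ (hV.sub_mem hb hc) using 1
  rw [smul_sub]
  abel

theorem IsNhdsChain.exists_smul_mem {G A : Type*} [Monoid G] [TopologicalSpace G]
    [AddCommGroup A] [TopologicalSpace A] [DistribMulAction G A] [ContinuousSMul G A]
    {V : ℕ → Set A} (hV : IsNhdsChain V) {K : Set G} (hK : IsCompact K) (n : ℕ) :
    ∃ j, ∀ g ∈ K, ∀ a ∈ V j, g • a ∈ V n := by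
  have eventually_smul_mem : ∀ᶠ a in 𝓝 (0 : A), ∀ g ∈ K, g • a ∈ V n := by
    refine hK.eventually_forall_of_forall_eventually fun g _ => ?_
    have continuous_swap_smul : Continuous fun z : A × G => z.2 • z.1 :=
      continuous_snd.smul continuous_fst
    exact (continuous_swap_smul.tendsto' (0, g) 0 (smul_zero g)).eventually (hV.mem_nhds n)
  obtain ⟨j, hj⟩ := hV.exists_subset _ eventually_smul_mem
  exact ⟨j, fun g hg a ha => hj ha g hg⟩

variable {G : Type*} [Group G] [TopologicalSpace G] [IsTopologicalGroup G]
  [LocallyCompactSpace G] [SecondCountableTopology G] [MeasurableSpace G] [BorelSpace G]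
  {μ : Measure G} [μ.IsHaarMeasure]

theorem tendsto_measure_translate_symmDiff [T2Space G] {m : ℕ} {E : Set (Fin m → G)}
    (hE : MeasurableSet E) (hE_top : powMeasure μ m E ≠ ∞) :
    Tendsto (fun g : G => powMeasure μ m
      (symmDiff ((fun (x : Fin m → G) i => g⁻¹ * x i) ⁻¹' E) E)) (𝓝 1) (𝓝 0) := by
  have : (powMeasure μ m).InnerRegularCompactLTTop := by
    let := TopologicalSpace.metrizableSpaceMetric (Fin m → G)
    infer_instance
  let T : C(G × (Fin m → G), Fin m → G) := ⟨fun z i => z.1⁻¹ * z.2 i, by fun_prop⟩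
  have curry_one : T.curry 1 ⁻¹' E = E := by
    have : ⇑(T.curry 1) = id := funext fun x => funext fun i => by
      simp only [T, ContinuousMap.curry_apply, ContinuousMap.coe_mk, inv_one, one_mul, id_eq]
    rw [this, Set.preimage_id]
  have tendsto_symmDiff := tendsto_measure_symmDiff_preimage_nhds_zero
    (T.curry.continuous.tendsto 1)
    (Eventually.of_forall fun g => measurePreserving_translate μ m g⁻¹)
    (measurePreserving_translate μ m 1⁻¹) hE.nullMeasurableSet hE_top
  rwa [curry_one] at tendsto_symmDiff

theorem eventually_measure_biUnion_translate_symmDiff_le [T2Space G] {m : ℕ} {ι : Type*}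
    (s : Finset ι) {E : ι → Set (Fin m → G)} (hE : ∀ i, MeasurableSet (E i))
    (hE_top : ∀ i, powMeasure μ m (E i) ≠ ∞) {ε : ℝ≥0∞} (hε : 0 < ε) :
    ∀ᶠ g in 𝓝 (1 : G), powMeasure μ m
      (⋃ i ∈ s, symmDiff ((fun (x : Fin m → G) k => g⁻¹ * x k) ⁻¹' E i) (E i)) ≤ ε := by
  have tendsto_sum := tendsto_finsetSum s fun i _ =>
    tendsto_measure_translate_symmDiff (μ := μ) (hE i) (hE_top i)
  rw [Finset.sum_const_zero] at tendsto_sum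
  filter_upwards [ENNReal.tendsto_nhds_zero.1 tendsto_sum ε hε] with g hg
  exact (measure_biUnion_finset_le _ _).trans hg

variable {A : Type*} [AddCommGroup A] [TopologicalSpace A] [IsTopologicalAddGroup A]
  [DistribMulAction G A] [ContinuousSMul G A] {V : ℕ → Set A} {C : CompactExhaustion G}

theorem diagAct_one {m : ℕ} (φ : Cochain μ A m) : diagAct μ (1 : G) φ = φ :=
  AEEqFun.ext ((coeFn_diagAct μ A 1 φ).trans (Eventually.of_forall fun x => by
    simp only [inv_one, one_mul, one_smul]))

theorem diagAct_mul {m : ℕ} (g h : G) (φ : Cochain μ A m) :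
    diagAct μ (g * h) φ = diagAct μ g (diagAct μ h φ) := by
  refine AEEqFun.ext ((coeFn_diagAct μ A _ φ).trans (EventuallyEq.symm ?_))
  filter_upwards [coeFn_diagAct μ A g (diagAct μ h φ),
    (measurePreserving_translate μ m g⁻¹).quasiMeasurePreserving.ae (coeFn_diagAct μ A h φ)]
    with x hxg hxh
  rw [hxg, hxh, mul_smul]
  simp only [mul_inv_rev, mul_assoc]

open scoped Pointwise in
theorem exists_diagAct_mem_smallInMeasure (hV : IsNhdsChain V) (C : CompactExhaustion G) (m : ℕ)
    {K : Set G} (hK : IsCompact K) (n : ℕ) :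
    ∃ j, ∀ g ∈ K, ∀ φ ∈ smallInMeasure (powMeasure μ m) (powExhaustion C m) V j,
      diagAct μ g φ ∈ smallInMeasure (powMeasure μ m) (powExhaustion C m) V n := by
  obtain ⟨i, hi⟩ := hV.exists_smul_mem hK n
  obtain ⟨l, hl⟩ := C.exists_superset_of_isCompact (hK.inv.mul (C.isCompact n))
  refine ⟨n + i + l, fun g hg φ hφ => mem_smallInMeasure_of_ae
    (E := (fun (x : Fin m → G) i => g⁻¹ * x i) ⁻¹'
      {y | y ∈ powExhaustion C m (n + i + l) ∧ φ y ∉ V (n + i + l)}) ?_ ?_⟩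
  · calc _ ≤ powMeasure μ m {y | y ∈ powExhaustion C m (n + i + l) ∧ φ y ∉ V (n + i + l)} :=
          (measurePreserving_translate μ m g⁻¹).measure_preimage_le _
      _ ≤ 2⁻¹ ^ (n + i + l) := hφ
      _ ≤ 2⁻¹ ^ n := pow_le_pow_right_of_le_one' (ENNReal.inv_le_one.2 one_le_two) (by omega)
  · filter_upwards [coeFn_diagAct μ A g φ] with x hx hxC hx_bad
    rw [hx]
    have translate_mem : (fun i => g⁻¹ * x i) ∈ powExhaustion C m (n + i + l) := fun k hk =>
      C.subset (by omega) (hl (Set.mul_mem_mul (Set.inv_mem_inv.2 hg) (hxC k hk)))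
    exact hi g hg _ (hV.antitone (show i ≤ n + i + l by omega)
      (of_not_not fun hxV => hx_bad ⟨translate_mem, hxV⟩))

theorem eventually_diagAct_sub_mem_one [T2Space G] [TopologicalSpace.SeparableSpace A]
    [TopologicalSpace.PseudoMetrizableSpace A] (hV : IsNhdsChain V) {m : ℕ} (φ : Cochain μ A m)
    (n : ℕ) : ∀ᶠ g in 𝓝 (1 : G),
      diagAct μ g φ - φ ∈ smallInMeasure (powMeasure μ m) (powExhaustion C m) V n := by
  borelize A
  obtain ⟨L, hL, hL_nhds⟩ := exists_compact_mem_nhds (1 : G)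
  obtain ⟨j, hj⟩ := hV.exists_smul_mem hL (n + 1)
  let l := j + n + 2
  let D := powExhaustion C m n
  have hD : IsCompact D := (powExhaustion C m).isCompact n
  have half_pos : 0 < (2⁻¹ : ℝ≥0∞) ^ (n + 1) :=
    ENNReal.pow_pos (ENNReal.inv_pos.2 ENNReal.ofNat_ne_top) _
  obtain ⟨s, hs⟩ := exists_finset_measure_sdiff_biUnion_le (hV.isOpen l) (hV.zero_mem l)
    φ.stronglyMeasurable hD.measurableSet (hD.measure_lt_top (μ := powMeasure μ m)).ne half_pos
  let E (b : A) : Set (Fin m → G) := D ∩ {y | φ y - b ∈ V l}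
  have measurableSet_E (b : A) : MeasurableSet (E b) := hD.measurableSet.inter
    (φ.stronglyMeasurable.measurable.sub_const b (hV.isOpen l).measurableSet)
  have eventually_symmDiff := eventually_measure_biUnion_translate_symmDiff_le (μ := μ) s
    measurableSet_E (fun b => measure_ne_top_of_subset Set.inter_subset_left
      (hD.measure_lt_top (μ := powMeasure μ m)).ne) half_pos
  have eventually_smul : ∀ᶠ g in 𝓝 (1 : G), ∀ b ∈ s, g • b - b ∈ V l :=
    (Finset.eventually_all _).2 fun b _ => hV.tendsto_iff.1
      ((continuous_id.smul continuous_const).tendsto' 1 b (one_smul G b)) l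
  filter_upwards [eventually_symmDiff, eventually_smul, hL_nhds] with g hg_symmDiff hg_smul hgL
  refine mem_smallInMeasure_of_ae (E := (D \ ⋃ b ∈ s, {y | φ y - b ∈ V l}) ∪
    ⋃ b ∈ s, symmDiff ((fun (x : Fin m → G) i => g⁻¹ * x i) ⁻¹' E b) (E b))
    ((measure_union_le _ _).trans ((add_le_add hs hg_symmDiff).trans_eq
      (inv_two_pow_succ_add_self n))) ?_
  filter_upwards [AEEqFun.coeFn_sub (diagAct μ g φ) φ, coeFn_diagAct μ A g φ]
    with y hy_sub hy_act hyD hy_good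
  rw [Set.mem_union, not_or] at hy_good
  obtain ⟨b, hb, hyb⟩ : ∃ b ∈ s, φ y - b ∈ V l := by
    by_contra! h
    exact hy_good.1 ⟨hyD, by
      simpa only [Set.mem_iUnion, exists_prop, not_exists, not_and, Set.mem_ofPred_eq] using h⟩
  have translate_mem : (fun i => g⁻¹ * y i) ∈ E b := of_not_not fun h =>
    hy_good.2 (Set.mem_biUnion (x := b) hb (.inr ⟨⟨hyD, hyb⟩, h⟩))
  have value_close := hj g hgL _ (hV.antitone (show j ≤ l by omega) translate_mem.2)
  rw [hy_sub, Pi.sub_apply, hy_act]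
  exact hV.smul_sub_mem value_close (hV.antitone (show n + 2 ≤ l by omega) (hg_smul b hb))
    (hV.antitone (show n + 2 ≤ l by omega) hyb)

theorem isContinuousFamily_diagAct [T2Space G] [TopologicalSpace.SeparableSpace A]
    [TopologicalSpace.PseudoMetrizableSpace A] (hV : IsNhdsChain V) (C : CompactExhaustion G)
    (m : ℕ) : IsContinuousFamily (smallInMeasure (powMeasure μ m) (powExhaustion C m) V)
      fun g : G => diagAct μ g where
  exists_forall_mem _ hK n := exists_diagAct_mem_smallInMeasure hV C m hK n
  eventually_sub_mem φ n g₀ := by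
    obtain ⟨j, hj⟩ := exists_diagAct_mem_smallInMeasure (μ := μ) hV C m
      (isCompact_singleton (x := g₀)) n
    have tendsto_one : Tendsto (fun g => g₀⁻¹ * g) (𝓝 g₀) (𝓝 1) :=
      (continuous_const_mul g₀⁻¹).tendsto' g₀ 1 (inv_mul_cancel g₀)
    filter_upwards [tendsto_one.eventually (eventually_diagAct_sub_mem_one (C := C) hV φ j)]
      with g hg
    simpa only [map_sub, ← diagAct_mul, mul_inv_cancel_left] using hj g₀ rfl _ hg

end ActionContinuity

section AlternatingSum

variable {G E F : Type*} [AddCommGroup E] [AddCommGroup F] {k : ℕ}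

theorem map_dFun (q : E →+ F) (b : (Fin k → G) → E) (x : Fin (k + 1) → G) :
    q (dFun b x) = dFun (fun z => q (b z)) x := by
  simp only [dFun, map_sum, map_zsmul]

theorem dFun_zsmul (c : ℤ) (f : (Fin k → G) → E) (x : Fin (k + 1) → G) :
    dFun (c • f) x = c • dFun f x := by
  simp only [dFun, Pi.smul_apply, Finset.smul_sum, smul_comm c]

theorem dFun_sub (f g : (Fin k → G) → E) (x : Fin (k + 1) → G) :
    dFun (f - g) x = dFun f x - dFun g x := by
  simp only [dFun, Pi.sub_apply, smul_sub, Finset.sum_sub_distrib]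

end AlternatingSum

section Homogeneous

variable {G : Type*} [Group G] [TopologicalSpace G] [IsTopologicalGroup G]
  [LocallyCompactSpace G] [SecondCountableTopology G] [MeasurableSpace G] [BorelSpace G]
  {μ : Measure G} [μ.IsHaarMeasure]

theorem measurePreserving_cons_mul (μ : Measure G) [μ.IsHaarMeasure] (k : ℕ) :
    MeasurePreserving
      (fun w : G × (Fin k → G) => Fin.cons (α := fun _ => G) w.1 fun i => w.1 * w.2 i)
      (μ.prod (powMeasure μ k)) (powMeasure μ (k + 1)) := by
  convert (measurePreserving_piFinSuccAbove (fun _ => μ) 0).symm.comp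
    ((MeasurePreserving.id μ).skew_product (g := fun t (y : Fin k → G) i => t * y i) (by fun_prop)
      (Eventually.of_forall fun t => (measurePreserving_translate μ k t).map_eq)) using 1
  exact funext fun w => (Fin.insertNth_zero' w.1 fun i => w.1 * w.2 i).symm

theorem measurePreserving_prodMk_inv_mul_succ (μ : Measure G) [μ.IsHaarMeasure] (k : ℕ) :
    MeasurePreserving (fun x : Fin (k + 1) → G => (x 0, fun i : Fin k => (x 0)⁻¹ * x i.succ))
      (powMeasure μ (k + 1)) (μ.prod (powMeasure μ k)) :=
  ((MeasurePreserving.id μ).skew_product (g := fun t (y : Fin k → G) i => t⁻¹ * y i)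
    (by fun_prop) (Eventually.of_forall fun t =>
      (measurePreserving_translate μ k t⁻¹).map_eq)).comp
    (measurePreserving_piFinSuccAbove (fun _ => μ) 0)

variable {A : Type*} [AddCommGroup A] [TopologicalSpace A] [IsTopologicalAddGroup A]
  [DistribMulAction G A] [ContinuousSMul G A] {k m : ℕ}

/-- The homogeneous cochain on `G^(k+1)`, with values in `C(G^m, A)`, whose restriction to
`x₀ = 1` is `u`. -/
noncomputable def homog (u : (Fin k → G) → Cochain μ A m) (x : Fin (k + 1) → G) : Cochain μ A m :=
  diagAct μ (x 0) (u fun i => (x 0)⁻¹ * x i.succ)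

theorem homog_translate (u : (Fin k → G) → Cochain μ A m) (g : G) (x : Fin (k + 1) → G) :
    homog u (fun i => g * x i) = diagAct μ g (homog u x) := by
  simp only [homog, diagAct_mul, mul_inv_rev, mul_assoc, inv_mul_cancel_left]

theorem homog_cons_one (u : (Fin k → G) → Cochain μ A m) (z : Fin k → G) :
    homog u (Fin.cons (α := fun _ => G) 1 z) = u z := by
  simp only [homog, Fin.cons_zero, Fin.cons_succ, inv_one, one_mul, diagAct_one]

theorem dFun_translate {b : (Fin k → G) → Cochain μ A m}
    (hb : ∀ g x, b (fun i => g * x i) = diagAct μ g (b x)) (g : G) (x : Fin (k + 1) → G) :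
    dFun b (fun i => g * x i) = diagAct μ g (dFun b x) := by
  rw [map_dFun]
  exact Finset.sum_congr rfl fun i _ => congrArg _ (hb g (i.removeNth x))

theorem eq_homog {b : (Fin (k + 1) → G) → Cochain μ A m}
    (hb : ∀ g x, b (fun i => g * x i) = diagAct μ g (b x)) (x : Fin (k + 1) → G) :
    b x = homog (fun z => b (Fin.cons (α := fun _ => G) 1 z)) x := by
  rw [homog, ← hb]
  congr 1
  ext i
  cases i using Fin.cases with
  | zero => rw [Fin.cons_zero, mul_one]
  | succ i => rw [Fin.cons_succ, mul_inv_cancel_left]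

theorem d_homog (u : (Fin k → G) → Cochain μ A m) (x : Fin (k + 1) → G) :
    d μ A m (homog u x) = homog (fun z => d μ A m (u z)) x :=
  (diagAct_d μ A _ _).symm

variable {C : CompactExhaustion G} {V : ℕ → Set A}

theorem exists_homog_eq_dFun [PolishSpace A] (hV : IsNhdsChain V)
    {b : (Fin k → G) → Cochain μ A (m + 1)}
    (hb : ∀ g x, b (fun i => g * x i) = diagAct μ g (b x))
    (hb_lim : IsTypeILimitAt (smallInMeasure (powMeasure μ (m + 1)) (powExhaustion C (m + 1)) V)
      (powMeasure μ k) 1 fun z => dFun b (Fin.cons (α := fun _ => G) 1 z))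
    (hd : ∀ x, d μ A (m + 1) (dFun b x) = 0) (l : ℕ) :
    ∃ v : (Fin k → G) → Cochain μ A m,
      IsTypeILimitAt (smallInMeasure (powMeasure μ m) (powExhaustion C m) V)
        (powMeasure μ k) 1 v ∧
      ∀ x, d μ A m (homog v x) = (-1 : ℤ) ^ l • dFun b x := by
  obtain ⟨v, hv, hdv⟩ := IsTypeILimitAt.exists_lift hV.smallInMeasure
    (isCompleteChain_smallInMeasure hV) hV.smallInMeasure (isStrictOnto_d hV C m)
    (hb_lim.neg_one_pow_smul hV.smallInMeasure l)
    fun z => by rw [AddMonoidHom.mem_ker, map_zsmul, hd, smul_zero]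
  refine ⟨v, hv, fun x => ?_⟩
  rw [d_homog, eq_homog (dFun_translate hb) x]
  simp only [hdv, homog, map_zsmul]

variable [T2Space G]

theorem IsTypeILimitAt.homog [TopologicalSpace.SeparableSpace A]
    [TopologicalSpace.PseudoMetrizableSpace A] (hV : IsNhdsChain V)
    {u : (Fin k → G) → Cochain μ A m}
    (hu : IsTypeILimitAt (smallInMeasure (powMeasure μ m) (powExhaustion C m) V)
      (powMeasure μ k) 1 u) :
    IsTypeILimitAt (smallInMeasure (powMeasure μ m) (powExhaustion C m) V)
      (powMeasure μ (k + 1)) 1 (homog u) := by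
  have difference_one :
      (fun i : Fin k => ((1 : Fin (k + 1) → G) 0)⁻¹ * (1 : Fin (k + 1) → G) i.succ) = 1 := by
    ext
    simp only [Pi.one_apply, inv_one, one_mul]
  have difference_continuous :
      Continuous fun (x : Fin (k + 1) → G) (i : Fin k) => (x 0)⁻¹ * x i.succ := by fun_prop
  rw [← difference_one] at hu
  exact IsTypeILimitAt.twist (ρ := fun g : G => diagAct μ g) hV.smallInMeasure
    (isContinuousFamily_diagAct hV C m) hu difference_continuous
    (Measure.quasiMeasurePreserving_snd.comp
      (measurePreserving_prodMk_inv_mul_succ μ k).quasiMeasurePreserving) (continuous_apply 0)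
    (Measure.quasiMeasurePreserving_eval _ 0)

theorem IsTypeILimitAt.dFun_homog_cons_one [TopologicalSpace.SeparableSpace A]
    [TopologicalSpace.PseudoMetrizableSpace A] (hV : IsNhdsChain V)
    {u : (Fin k → G) → Cochain μ A m}
    (hu : IsTypeILimitAt (smallInMeasure (powMeasure μ m) (powExhaustion C m) V)
      (powMeasure μ k) 1 u) :
    IsTypeILimitAt (smallInMeasure (powMeasure μ m) (powExhaustion C m) V)
      (powMeasure μ (k + 1)) 1
      fun z => dFun (MooreCohomology.homog u) (Fin.cons (α := fun _ => G) 1 z) := by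
  have hW := hV.smallInMeasure (ν := powMeasure μ m) (K := powExhaustion C m)
  refine .sum hW _ fun i => .neg_one_pow_smul hW ?_ _
  cases i using Fin.cases with
  | zero => exact hu.homog hV
  | succ j =>
    have removeNth_cons (z : Fin (k + 1) → G) :
        j.succ.removeNth (Fin.cons (α := fun _ => G) 1 z) =
          Fin.cons (α := fun _ => G) 1 (j.removeNth z) := by
      ext i
      cases i using Fin.cases with
      | zero => rfl
      | succ i => simp only [Fin.removeNth, Fin.succ_succAbove_succ, Fin.cons_succ]
    simp only [removeNth_cons, homog_cons_one]
    exact IsTypeILimitAt.comp_continuous (π := fun z => j.removeNth z) hu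
      (continuous_pi fun i => continuous_apply _) (quasiMeasurePreserving_removeNth μ j)

end Homogeneous

section Bidegree

variable {G : Type*} {A : Type*} [AddCommGroup A] {k m : ℕ}

/-- The alternating-sum differential in the first group of variables. -/
def dLeft (F : (Fin k → G) × (Fin m → G) → A) : (Fin (k + 1) → G) × (Fin m → G) → A :=
  fun z => dFun (fun x => F (x, z.2)) z.1

/-- The alternating-sum differential in the second group of variables. -/
def dRight (F : (Fin k → G) × (Fin m → G) → A) : (Fin k → G) × (Fin (m + 1) → G) → A :=
  fun z => dFun (fun y => F (z.1, y)) z.2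

theorem dLeft_sub (F H : (Fin k → G) × (Fin m → G) → A) : dLeft (F - H) = dLeft F - dLeft H :=
  funext fun z => dFun_sub (fun x => F (x, z.2)) (fun x => H (x, z.2)) z.1

theorem dRight_sub (F H : (Fin k → G) × (Fin m → G) → A) : dRight (F - H) = dRight F - dRight H :=
  funext fun z => dFun_sub (fun y => F (z.1, y)) (fun y => H (z.1, y)) z.2

theorem dLeft_zsmul (c : ℤ) (F : (Fin k → G) × (Fin m → G) → A) : dLeft (c • F) = c • dLeft F :=
  funext fun z => dFun_zsmul c (fun x => F (x, z.2)) z.1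

theorem dRight_zsmul (c : ℤ) (F : (Fin k → G) × (Fin m → G) → A) :
    dRight (c • F) = c • dRight F :=
  funext fun z => dFun_zsmul c (fun y => F (z.1, y)) z.2

theorem dLeft_dLeft (F : (Fin k → G) × (Fin m → G) → A) : dLeft (dLeft F) = 0 :=
  funext fun z => dFun_dFun (fun x => F (x, z.2)) z.1

theorem dRight_dLeft (F : (Fin k → G) × (Fin m → G) → A) :
    dRight (dLeft F) = dLeft (dRight F) := by
  funext z
  simp only [dRight, dLeft, dFun, Finset.smul_sum]
  rw [Finset.sum_comm]
  exact Finset.sum_congr rfl fun i _ => Finset.sum_congr rfl fun j _ => smul_comm _ _ _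

/-- Equivariance at every point under the diagonal action. -/
def IsEquivariant [Group G] [DistribMulAction G A] (F : (Fin k → G) × (Fin m → G) → A) : Prop :=
  ∀ g x y, F (fun i => g * x i, fun i => g * y i) = g • F (x, y)

variable [Group G] [DistribMulAction G A] {F H : (Fin k → G) × (Fin m → G) → A}

theorem IsEquivariant.sub (hF : IsEquivariant F) (hH : IsEquivariant H) : IsEquivariant (F - H) :=
  fun g x y => by simp only [Pi.sub_apply, hF g x y, hH g x y, smul_sub]

theorem IsEquivariant.zsmul (hF : IsEquivariant F) (c : ℤ) : IsEquivariant (c • F) :=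
  fun g x y => by simp only [Pi.smul_apply, hF g x y, smul_comm g c]

theorem IsEquivariant.dLeft (hF : IsEquivariant F) : IsEquivariant (dLeft F) := fun g x y => by
  simp only [MooreCohomology.dLeft, dFun, Finset.smul_sum]
  refine Finset.sum_congr rfl fun i _ => ?_
  rw [smul_comm g]
  exact congrArg _ (hF g (i.removeNth x) y)

end Bidegree

section Concat

variable {G : Type*} [One G] {k m n : ℕ}

/-- The extension of a tuple to all of `ℕ` by ones. -/
def padOne (x : Fin k → G) (l : ℕ) : G :=
  if h : l < k then x ⟨l, h⟩ else 1

/-- The concatenation of two tuples, cut off or padded with ones to length `n`. With the length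
as a free parameter, removing an entry of `x` or of `y` needs no casts between index types. -/
def concat (n : ℕ) (x : Fin k → G) (y : Fin m → G) : Fin n → G := fun i =>
  if (i : ℕ) < k then padOne x i else padOne y (i - k)

theorem padOne_val (x : Fin k → G) (i : Fin k) : padOne x i = x i :=
  dif_pos i.2

theorem padOne_of_le (x : Fin k → G) {l : ℕ} (h : k ≤ l) : padOne x l = 1 :=
  dif_neg h.not_gt

theorem val_succAbove (i : Fin (n + 1)) (j : Fin n) :
    (i.succAbove j : ℕ) = if (j : ℕ) < i then (j : ℕ) else j + 1 := by
  simp only [Fin.succAbove, Fin.lt_def, Fin.val_castSucc]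
  split_ifs <;> rfl

theorem padOne_removeNth (x : Fin (k + 1) → G) (i : Fin (k + 1)) (l : ℕ) :
    padOne (i.removeNth x) l = if l < i then padOne x l else padOne x (l + 1) := by
  have := i.2
  rcases lt_or_ge l k with h | h
  · lift l to Fin k using h
    rw [padOne_val, Fin.removeNth_apply, ← padOne_val x, val_succAbove, apply_ite (padOne x)]
  · rw [padOne_of_le _ h, if_neg (by omega), padOne_of_le _ (by omega)]

theorem concat_eq_append (x : Fin k → G) (y : Fin m → G) :
    concat (k + m) x y = Fin.append x y := by
  ext i
  cases i using Fin.addCases with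
  | left i => rw [Fin.append_left, concat, Fin.val_castAdd, if_pos i.2, padOne_val]
  | right j =>
    rw [Fin.append_right, concat, Fin.val_natAdd, if_neg (by omega), Nat.add_sub_cancel_left,
      padOne_val]

theorem concat_translate {G : Type*} [Group G] (h : n = k + m) (g : G) (x : Fin k → G)
    (y : Fin m → G) :
    concat n (fun i => g * x i) (fun i => g * y i) = fun i => g * concat n x y i := by
  subst h
  simp only [concat_eq_append]
  ext i
  cases i using Fin.addCases with
  | left i => simp only [Fin.append_left]
  | right j => simp only [Fin.append_right]

theorem concat_zero (x : Fin n → G) (y : Fin 0 → G) : concat n x y = x := by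
  ext i
  rw [concat, if_pos i.2, padOne_val]

theorem zero_concat (x : Fin 0 → G) (y : Fin n → G) : concat n x y = y := by
  ext i
  rw [concat, if_neg (Nat.not_lt_zero _), Nat.sub_zero, padOne_val]

theorem removeNth_concat_left (x : Fin (k + 1) → G) (y : Fin m → G)
    (i : Fin (n + 1)) (i' : Fin (k + 1)) (hi : (i : ℕ) = i') :
    i.removeNth (concat (n + 1) x y) = concat n (i'.removeNth x) y := by
  ext j
  have := i'.2
  simp only [concat, Fin.removeNth_apply, val_succAbove, padOne_removeNth]
  rcases lt_or_ge (j : ℕ) i with h | h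
  · rw [if_pos h, if_pos (by omega), if_pos (by omega), if_pos (by omega)]
  · rw [if_neg h.not_gt]
    by_cases hj : (j : ℕ) < k
    · rw [if_pos (by omega), if_pos (by omega), if_neg (by omega)]
    · rw [if_neg (by omega), if_neg (by omega), Nat.add_sub_add_right]

theorem removeNth_concat_right (x : Fin k → G) (y : Fin (m + 1) → G)
    (i : Fin (n + 1)) (j : Fin (m + 1)) (hi : (i : ℕ) = k + j) :
    i.removeNth (concat (n + 1) x y) = concat n x (j.removeNth y) := by
  ext l
  simp only [concat, Fin.removeNth_apply, val_succAbove, padOne_removeNth]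
  rcases lt_or_ge (l : ℕ) i with h | h
  · rw [if_pos h]
    by_cases hl : (l : ℕ) < k
    · rw [if_pos (by omega), if_pos (by omega)]
    · rw [if_neg (by omega), if_neg (by omega), if_pos (by omega)]
  · rw [if_neg h.not_gt, if_neg (by omega), if_neg (by omega), if_neg (by omega),
      Nat.sub_add_comm (by omega)]

/-- `f` as a function of its first `k` and its last `m` variables; only the case `n = k + m` is
meaningful. -/
def splitVars {A : Type*} (f : (Fin n → G) → A) (z : (Fin k → G) × (Fin m → G)) : A :=
  f (concat n z.1 z.2)

theorem dFun_concat {A : Type*} [AddCommGroup A] (h : n = k + 1 + m)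
    (f : (Fin n → G) → A) (x : Fin (k + 1) → G) (y : Fin (m + 1) → G) :
    dFun f (concat (n + 1) x y) =
      (-1 : ℤ) ^ (m + 1) • dLeft (splitVars f) (x, y) + dRight (splitVars f) (x, y) := by
  subst h
  simp only [dFun, dLeft, dRight, splitVars, Finset.smul_sum]
  refine (Fin.sum_univ_add (a := k + 1) (b := m + 1) _).trans ?_
  congr 1
  · refine Finset.sum_congr rfl fun i _ => ?_
    have sign_eq : k + 1 + m - (Fin.castAdd (m + 1) i : ℕ) = m + 1 + (k - i) := by
      have := i.2
      rw [Fin.val_castAdd]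
      omega
    rw [smul_smul, ← pow_add, sign_eq]
    exact congrArg _ (congrArg f (removeNth_concat_left x y _ i rfl))
  · refine Finset.sum_congr rfl fun j _ => ?_
    have sign_eq : k + 1 + m - (Fin.natAdd (k + 1) j : ℕ) = m - j := by
      rw [Fin.val_natAdd]
      omega
    rw [sign_eq]
    exact congrArg _ (congrArg f (removeNth_concat_right x y _ j rfl))

theorem measurable_concat [MeasurableSpace G] :
    Measurable fun z : (Fin k → G) × (Fin m → G) => concat n z.1 z.2 := by
  refine measurable_pi_lambda _ fun i => ?_
  simp only [concat, padOne]
  split_ifs <;> fun_prop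

theorem measurePreserving_concat [MeasurableSpace G] (μ : Measure G) [SigmaFinite μ]
    (h : n = k + m) :
    MeasurePreserving (fun z : (Fin k → G) × (Fin m → G) => concat n z.1 z.2)
      ((powMeasure μ k).prod (powMeasure μ m)) (powMeasure μ n) := by
  subst h
  refine ⟨measurable_concat, (Measure.pi_eq fun s hs => ?_).symm⟩
  have preimage_pi : (fun z : (Fin k → G) × (Fin m → G) => concat (k + m) z.1 z.2) ⁻¹'
      Set.univ.pi s =
        (Set.univ.pi fun i => s (Fin.castAdd m i)) ×ˢ
          Set.univ.pi fun j => s (Fin.natAdd k j) := by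
    ext z
    simp only [Set.mem_preimage, Set.mem_univ_pi, Set.mem_prod, concat_eq_append,
      Fin.forall_fin_add, Fin.append_left, Fin.append_right]
  rw [Measure.map_apply measurable_concat (.univ_pi hs), preimage_pi, Measure.prod_prod,
    Measure.pi_pi, Measure.pi_pi, Fin.prod_univ_add]

end Concat

section Exact

/-- The map that appends `x₀ t` to the second group of variables. It commutes with diagonal
translations, so composing with it preserves equivariance. -/
def appendMul {G : Type*} [Mul G] {k m : ℕ} (t : G) (z : (Fin (k + 1) → G) × (Fin m → G)) :
    (Fin (k + 1) → G) × (Fin (m + 1) → G) :=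
  (z.1, Fin.snoc (α := fun _ => G) z.2 (z.1 0 * t))

theorem appendMul_translate {G : Type*} [Semigroup G] {k m : ℕ} (t g : G) (x : Fin (k + 1) → G)
    (y : Fin m → G) :
    appendMul t (fun i => g * x i, fun i => g * y i) =
      (fun i => g * (appendMul t (x, y)).1 i, fun i => g * (appendMul t (x, y)).2 i) := by
  refine Prod.ext rfl (funext fun i => ?_)
  cases i using Fin.lastCases with
  | last => simp only [appendMul, Fin.snoc_last, mul_assoc]
  | cast i => simp only [appendMul, Fin.snoc_castSucc]

variable {G : Type*} [MeasurableSpace G] {A : Type*} [AddCommGroup A] {k m : ℕ}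
  {F H : (Fin k → G) × (Fin m → G) → A}

/-- The measure `μ^k × μ^m` on `G^k × G^m`. -/
noncomputable abbrev biMeasure (μ : Measure G) (k m : ℕ) : Measure ((Fin k → G) × (Fin m → G)) :=
  (powMeasure μ k).prod (powMeasure μ m)

theorem measurable_removeNth (i : Fin (k + 1)) :
    Measurable fun x : Fin (k + 1) → G => i.removeNth x :=
  measurable_pi_lambda _ fun _ => measurable_pi_apply _

theorem dLeft_congr {μ : Measure G} [SigmaFinite μ] (h : F =ᵐ[biMeasure μ k m] H) :
    dLeft F =ᵐ[biMeasure μ (k + 1) m] dLeft H := by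
  have faces_eq : ∀ᵐ z ∂biMeasure μ (k + 1) m, ∀ i : Fin (k + 1),
      F (i.removeNth z.1, z.2) = H (i.removeNth z.1, z.2) :=
    ae_all_iff.2 fun i => (QuasiMeasurePreserving.prodMap
      (quasiMeasurePreserving_removeNth μ i) (.id (powMeasure μ m))).ae h
  filter_upwards [faces_eq] with z hz
  simp only [dLeft, dFun, hz]

theorem ae_eq_zero_of_dRight_ae_eq_zero {μ : Measure G} [SigmaFinite μ] [NeZero μ]
    {F : (Fin k → G) × (Fin 0 → G) → A} (h : dRight F =ᵐ[biMeasure μ k 1] 0) :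
    F =ᵐ[biMeasure μ k 0] 0 := by
  have : NeZero (powMeasure μ 1) := ⟨fun h => NeZero.ne μ <| Measure.measure_univ_eq_zero.1 <| by
    simpa only [Measure.pi_univ, Finset.univ_unique, Finset.prod_singleton, Measure.coe_zero,
      Pi.zero_apply] using congrArg (fun ν => ν Set.univ) h⟩
  have eq_zero_at_default : ∀ᵐ x ∂powMeasure μ k, F (x, default) = 0 := by
    filter_upwards [Measure.ae_ae_of_ae_prod h] with x hx
    obtain ⟨y, hy⟩ := hx.exists
    simpa [dRight, dFun, Subsingleton.elim _ (default : Fin 0 → G)] using hy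
  filter_upwards [Measure.quasiMeasurePreserving_fst.ae eq_zero_at_default] with z hz
  rwa [← Prod.mk.eta (p := z), Subsingleton.elim z.2 default]

theorem measurePreserving_appendMul [Group G] [MeasurableMul₂ G] (μ : Measure G) [SigmaFinite μ]
    [μ.IsMulLeftInvariant] (k m : ℕ) :
    MeasurePreserving (fun w : G × ((Fin (k + 1) → G) × (Fin m → G)) => appendMul w.1 w.2)
      (μ.prod (biMeasure μ (k + 1) m)) (biMeasure μ (k + 1) (m + 1)) := by
  have skew : MeasurePreserving
      (fun w : (Fin (k + 1) → G) × G × (Fin m → G) =>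
        (w.1, Fin.snoc (α := fun _ => G) w.2.2 (w.1 0 * w.2.1)))
      ((powMeasure μ (k + 1)).prod (μ.prod (powMeasure μ m))) (biMeasure μ (k + 1) (m + 1)) :=
    (MeasurePreserving.id _).skew_product
      (g := fun (x : Fin (k + 1) → G) (w : G × (Fin m → G)) =>
        Fin.snoc (α := fun _ => G) w.2 (x 0 * w.1))
      ((measurePreserving_snoc μ m).measurable.comp
        (f := fun w : (Fin (k + 1) → G) × G × (Fin m → G) => (w.1 0 * w.2.1, w.2.2))
        (by fun_prop))
      (Eventually.of_forall fun x => ((measurePreserving_snoc μ m).comp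
        ((measurePreserving_mul_left μ (x 0)).prod (.id (powMeasure μ m)))).map_eq)
  have permute :=
    (measurePreserving_prodAssoc (powMeasure μ (k + 1)) μ (powMeasure μ m)).comp
      (((Measure.measurePreserving_swap (μ := μ) (ν := powMeasure μ (k + 1))).prod
        (.id (powMeasure μ m))).comp
          (measurePreserving_prodAssoc μ (powMeasure μ (k + 1)) (powMeasure μ m)).symm)
  exact skew.comp permute

theorem exists_ae_eq_dRight [Group G] [MeasurableMul₂ G] {μ : Measure G} [SigmaFinite μ]
    [NeZero μ] [μ.IsMulLeftInvariant] [TopologicalSpace A] [DistribMulAction G A]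
    {F : (Fin (k + 1) → G) × (Fin (m + 1) → G) → A} (hF : StronglyMeasurable F)
    (hF_equivariant : IsEquivariant F) (hd : dRight F =ᵐ[biMeasure μ (k + 1) (m + 2)] 0) :
    ∃ H : (Fin (k + 1) → G) × (Fin m → G) → A, StronglyMeasurable H ∧ IsEquivariant H ∧
      F =ᵐ[biMeasure μ (k + 1) (m + 1)] dRight H := by
  obtain ⟨t, ht⟩ := (Measure.ae_ae_of_ae_prod
    ((measurePreserving_appendMul μ k (m + 1)).quasiMeasurePreserving.ae hd)).exists
  refine ⟨fun z => F (appendMul t z), hF.comp_measurable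
    ((measurePreserving_appendMul μ k m).measurable.comp measurable_prodMk_left), ?_, ?_⟩
  · intro g x y
    beta_reduce
    rw [appendMul_translate]
    exact hF_equivariant g _ _
  · filter_upwards [ht] with z hz
    exact sub_eq_zero.1 ((dFun_snoc (fun y => F (z.1, y)) (z.1 0 * t) z.2).symm.trans hz)

variable [TopologicalSpace A] [IsTopologicalAddGroup A]

theorem stronglyMeasurable_dLeft (hF : StronglyMeasurable F) : StronglyMeasurable (dLeft F) :=
  Finset.stronglyMeasurable_fun_sum Finset.univ fun i _ => (hF.comp_measurable
    (((measurable_removeNth i).comp measurable_fst).prodMk measurable_snd)).const_smul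
      ((-1 : ℤ) ^ (k - (i : ℕ)))

theorem stronglyMeasurable_dRight (hF : StronglyMeasurable F) : StronglyMeasurable (dRight F) :=
  Finset.stronglyMeasurable_fun_sum Finset.univ fun i _ => (hF.comp_measurable
    (measurable_fst.prodMk ((measurable_removeNth i).comp measurable_snd))).const_smul
      ((-1 : ℤ) ^ (m - (i : ℕ)))

end Exact

section Representatives

theorem IsJointRepresentative.ae_eq_prod {X Y : Type*} [MeasurableSpace X] [MeasurableSpace Y]
    {A : Type*} [TopologicalSpace A] [TopologicalSpace.MetrizableSpace A] {μ : Measure X}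
    {ν : Measure Y} [SFinite ν] {F H : X × Y → A} {b : X → Y →ₘ[ν] A}
    (hF : IsJointRepresentative F b) (hH : IsJointRepresentative H b) : F =ᵐ[μ.prod ν] H :=
  (Measure.ae_prod_iff_ae_ae
    (hF.stronglyMeasurable.measurableSet_eq_fun hH.stronglyMeasurable)).2
    (Eventually.of_forall fun x => (hF.ae_eq x).trans (hH.ae_eq x).symm)

variable {G : Type*} [MeasurableSpace G] {A : Type*} [AddCommGroup A] [TopologicalSpace A]
  [IsTopologicalAddGroup A] {k m : ℕ} {μ : Measure G} {F : (Fin k → G) × (Fin m → G) → A}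
  {b : (Fin k → G) → Cochain μ A m}

theorem IsJointRepresentative.zsmul (hF : IsJointRepresentative F b) (c : ℤ) :
    IsJointRepresentative (c • F) (c • b) where
  stronglyMeasurable := hF.stronglyMeasurable.const_smul c
  ae_eq x := by
    filter_upwards [hF.ae_eq x, AEEqFun.coeFn_smul c (b x)] with y hFy hby
    rw [Pi.smul_apply, Pi.smul_apply, hby, Pi.smul_apply, hFy]

theorem IsJointRepresentative.dLeft (hF : IsJointRepresentative F b) :
    IsJointRepresentative (dLeft F) (dFun b) where
  stronglyMeasurable := stronglyMeasurable_dLeft hF.stronglyMeasurable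
  ae_eq x := by
    have faces_eq : ∀ᵐ y ∂powMeasure μ m, ∀ i : Fin (k + 1),
        F (i.removeNth x, y) = b (i.removeNth x) y :=
      ae_all_iff.2 fun i => hF.ae_eq _
    have smul_eq : ∀ᵐ y ∂powMeasure μ m, ∀ i : Fin (k + 1),
        ((-1 : ℤ) ^ (k - (i : ℕ)) • b (i.removeNth x)) y =
          (-1 : ℤ) ^ (k - (i : ℕ)) • b (i.removeNth x) y :=
      ae_all_iff.2 fun i => AEEqFun.coeFn_smul _ _
    filter_upwards [faces_eq, smul_eq, coeFn_finsetSum Finset.univ fun i : Fin (k + 1) =>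
      (-1 : ℤ) ^ (k - (i : ℕ)) • b (i.removeNth x)] with y hFy hsmul hsum
    refine Eq.trans ?_ hsum.symm
    simp only [MooreCohomology.dLeft, dFun, hFy, hsmul]

end Representatives

section EquivariantRepresentatives

variable {G : Type*} [Group G] [TopologicalSpace G] [IsTopologicalGroup G]
  [LocallyCompactSpace G] [SecondCountableTopology G] [MeasurableSpace G] [BorelSpace G]
  {μ : Measure G} [μ.IsHaarMeasure]
  {A : Type*} [AddCommGroup A] [TopologicalSpace A] [IsTopologicalAddGroup A] {k m : ℕ}

theorem IsJointRepresentative.dRight {F : (Fin k → G) × (Fin m → G) → A}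
    {b : (Fin k → G) → Cochain μ A m} (hF : IsJointRepresentative F b) :
    IsJointRepresentative (dRight F) fun x => d μ A m (b x) where
  stronglyMeasurable := stronglyMeasurable_dRight hF.stronglyMeasurable
  ae_eq x := (dFun_congr μ A (hF.ae_eq x)).trans (coeFn_d μ A (b x)).symm

theorem exists_ae_eq_slice {Y B : Type*} [MeasurableSpace Y] [TopologicalSpace B]
    [TopologicalSpace.MetrizableSpace B] {ν : Measure Y} [SFinite ν] {Φ : G × Y → B}
    (hΦ : StronglyMeasurable Φ)
    (hΦ_inv : ∀ g : G, ∀ᵐ w ∂μ.prod ν, Φ w = Φ (g⁻¹ * w.1, w.2)) :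
    ∃ h : G, ∀ᵐ w ∂μ.prod ν, Φ w = Φ (h, w.2) := by
  have measurableSet_inv : MeasurableSet {z : G × (G × Y) | Φ z.2 = Φ (z.1⁻¹ * z.2.1, z.2.2)} :=
    (hΦ.comp_measurable measurable_snd).measurableSet_eq_fun (hΦ.comp_measurable (by fun_prop))
  have measurableSet_slice : MeasurableSet {z : (G × Y) × G | Φ z.1 = Φ (z.2, z.1.2)} :=
    (hΦ.comp_measurable measurable_fst).measurableSet_eq_fun (hΦ.comp_measurable (by fun_prop))
  have ae_ae_slice : ∀ᵐ w ∂μ.prod ν, ∀ᵐ h ∂μ, Φ w = Φ (h, w.2) := by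
    filter_upwards [(Measure.ae_ae_comm (μ := μ) (ν := μ.prod ν)
      (p := fun g w => Φ w = Φ (g⁻¹ * w.1, w.2)) measurableSet_inv).1
      (Eventually.of_forall hΦ_inv)] with w hw
    have mul_inv_qmp : Measure.QuasiMeasurePreserving (fun h => w.1 * h⁻¹) μ μ :=
      (measurePreserving_mul_left μ w.1).quasiMeasurePreserving.comp (quasiMeasurePreserving_inv μ)
    filter_upwards [mul_inv_qmp.ae hw] with h hh
    rwa [mul_inv_rev, inv_inv, inv_mul_cancel_right] at hh
  exact ((Measure.ae_ae_comm (μ := μ.prod ν) (ν := μ) (p := fun w h => Φ w = Φ (h, w.2))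
    measurableSet_slice).1 ae_ae_slice).exists

variable [DistribMulAction G A] [ContinuousSMul G A] [PolishSpace A]

theorem exists_isJointRepresentative_homog {C : CompactExhaustion G} {V : ℕ → Set A}
    (hV : IsNhdsChain V) {u : (Fin k → G) → Cochain μ A m}
    (hu : IsTypeILimitAt (smallInMeasure (powMeasure μ m) (powExhaustion C m) V)
      (powMeasure μ k) 1 u) :
    ∃ U : (Fin (k + 1) → G) × (Fin m → G) → A,
      IsJointRepresentative U (homog u) ∧ IsEquivariant U := by
  obtain ⟨U, hU⟩ := hu.exists_isJointRepresentative hV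
  refine ⟨fun z => z.1 0 • U (fun i => (z.1 0)⁻¹ * z.1 i.succ, fun i => (z.1 0)⁻¹ * z.2 i),
    ⟨?_, fun x => ?_⟩, fun g x y => ?_⟩
  · exact StronglyMeasurable.smul (f := fun z : (Fin (k + 1) → G) × (Fin m → G) => z.1 0)
      (Measurable.stronglyMeasurable (by fun_prop))
      (hU.stronglyMeasurable.comp_measurable (by fun_prop))
  · filter_upwards [coeFn_diagAct μ A (x 0) (u fun i => (x 0)⁻¹ * x i.succ),
      (measurePreserving_translate μ m (x 0)⁻¹).quasiMeasurePreserving.ae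
        (hU.ae_eq fun i => (x 0)⁻¹ * x i.succ)] with y h_act hUy
    rw [hUy]
    exact h_act.symm
  · simp only [mul_inv_rev, mul_assoc, inv_mul_cancel_left, mul_smul]

theorem exists_equivariant_ae_eq (φ : Cochain μ A (k + 1)) (hφ : ∀ g : G, diagAct μ g φ = φ) :
    ∃ σ : (Fin (k + 1) → G) → A, StronglyMeasurable σ ∧
      (∀ (g : G) x, σ (fun i => g * x i) = g • σ x) ∧ φ =ᵐ[powMeasure μ (k + 1)] σ := by
  let shear (w : G × (Fin k → G)) : Fin (k + 1) → G :=
    Fin.cons (α := fun _ => G) w.1 fun i => w.1 * w.2 i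
  have hshear := measurePreserving_cons_mul μ k
  have mul_shear (g : G) (w : G × (Fin k → G)) :
      (fun i => g * shear w i) = shear (g * w.1, w.2) := by
    ext i
    cases i using Fin.cases with
    | zero => rfl
    | succ i => simp only [shear, Fin.cons_succ, mul_assoc]
  -- In the coordinates `(x₀, x₀⁻¹ xᵢ)` equivariance makes `Φ` independent of the first variable.
  let Φ (w : G × (Fin k → G)) : A := w.1⁻¹ • φ (shear w)
  have hΦ : StronglyMeasurable Φ :=
    StronglyMeasurable.smul (f := fun w : G × (Fin k → G) => w.1⁻¹)
      (Measurable.stronglyMeasurable (by fun_prop))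
      (φ.stronglyMeasurable.comp_measurable hshear.measurable)
  obtain ⟨h, hh⟩ := exists_ae_eq_slice (μ := μ) (ν := powMeasure μ k) hΦ fun g => by
    have h_act := coeFn_diagAct μ A g φ
    rw [hφ g] at h_act
    filter_upwards [hshear.quasiMeasurePreserving.ae h_act] with w hw
    change w.1⁻¹ • φ (shear w) = (g⁻¹ * w.1)⁻¹ • φ (shear (g⁻¹ * w.1, w.2))
    rw [mul_inv_rev, inv_inv, mul_smul, ← mul_shear]
    exact congrArg _ hw
  refine ⟨fun x => x 0 • Φ (h, fun i => (x 0)⁻¹ * x i.succ), ?_, fun g x => ?_, ?_⟩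
  · exact StronglyMeasurable.smul (f := fun x : Fin (k + 1) → G => x 0)
      (Measurable.stronglyMeasurable (by fun_prop)) (hΦ.comp_measurable (by fun_prop))
  · simp only [mul_inv_rev, mul_assoc, inv_mul_cancel_left, mul_smul]
  · filter_upwards [(measurePreserving_prodMk_inv_mul_succ μ k).quasiMeasurePreserving.ae hh]
      with x hx
    have shear_unshear : shear (x 0, fun i => (x 0)⁻¹ * x i.succ) = x := by
      simp only [shear, mul_inv_cancel_left]
      exact Fin.cons_self_tail x
    rw [← hx]
    simp only [Φ, smul_inv_smul, shear_unshear]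

end EquivariantRepresentatives

section SplitVariables

variable {G A : Type*} {k m n : ℕ} {σ : (Fin n → G) → A}

theorem stronglyMeasurable_splitVars [One G] [MeasurableSpace G] [TopologicalSpace A]
    (hσ : StronglyMeasurable σ) :
    StronglyMeasurable (splitVars σ : (Fin k → G) × (Fin m → G) → A) :=
  hσ.comp_measurable measurable_concat

theorem isEquivariant_splitVars [Group G] [AddCommGroup A] [DistribMulAction G A] (h : n = k + m)
    (hσ : ∀ (g : G) x, σ (fun i => g * x i) = g • σ x) :
    IsEquivariant (splitVars σ : (Fin k → G) × (Fin m → G) → A) := fun g x y => by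
  rw [splitVars, concat_translate h, hσ, splitVars]

theorem dRight_splitVars_ae_eq [One G] [MeasurableSpace G] {μ : Measure G} [SigmaFinite μ]
    [AddCommGroup A] (h : n = k + 1 + m) (hσ : dFun σ =ᵐ[powMeasure μ (n + 1)] 0) :
    dRight (splitVars σ : (Fin (k + 1) → G) × (Fin m → G) → A)
      =ᵐ[biMeasure μ (k + 1) (m + 1)]
        (-1 : ℤ) ^ m • dLeft (splitVars σ : (Fin k → G) × (Fin (m + 1) → G) → A) := by
  filter_upwards [(measurePreserving_concat μ
    (show n + 1 = k + 1 + (m + 1) by omega)).quasiMeasurePreserving.ae hσ] with z hz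
  rw [dFun_concat h σ z.1 z.2, pow_succ, mul_neg_one, neg_smul] at hz
  exact (neg_add_eq_zero.1 hz).symm

end SplitVariables

section DimensionShift

variable {G : Type*} [Group G] [TopologicalSpace G] [IsTopologicalGroup G]
  [LocallyCompactSpace G] [SecondCountableTopology G]
  [MeasurableSpace G] [BorelSpace G] {μ : Measure G} [μ.IsHaarMeasure]
  {A : Type*} [AddCommGroup A] [TopologicalSpace A] [IsTopologicalAddGroup A]
  [DistribMulAction G A] [ContinuousSMul G A] {k m n : ℕ}
  {C : CompactExhaustion G} {V : ℕ → Set A} {σ : (Fin n → G) → A}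

/-- `v`, or rather the function `homog v` on `G^(k+1)` with values in `C(G^m, A)`, is obtained
from the cocycle `σ` of `n = k + 1 + m` variables by `k + 1` steps of dimension shifting: it is
an almost type-I function that agrees with `σ` up to a coboundary `dLeft H` and a cocycle of the
remaining variables. There are no `G`-invariant functions of no variables in the complex, which
is why `H` has to vanish for `k = 0`. -/
structure IsDimensionShift (C : CompactExhaustion G) (V : ℕ → Set A) (σ : (Fin n → G) → A)
    (v : (Fin k → G) → Cochain μ A m) : Prop where
  isTypeILimitAt : IsTypeILimitAt (smallInMeasure (powMeasure μ m) (powExhaustion C m) V)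
    (powMeasure μ k) 1 v
  d_dFun_homog : ∀ x, d μ A m (dFun (homog v) x) = 0
  exists_ae_eq : ∃ U : (Fin (k + 1) → G) × (Fin m → G) → A,
    IsJointRepresentative U (homog v) ∧ IsEquivariant U ∧
    ∃ H : (Fin k → G) × (Fin m → G) → A, StronglyMeasurable H ∧ IsEquivariant H ∧
      (k = 0 → H = 0) ∧ dRight (U - splitVars σ - dLeft H) =ᵐ[biMeasure μ (k + 1) (m + 1)] 0

variable [PolishSpace A]

theorem exists_isDimensionShift_of_dLeft_ae_eq (hV : IsNhdsChain V) (h : n = k + 1 + m)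
    (hσd : dFun σ =ᵐ[powMeasure μ (n + 1)] 0) {b : (Fin k → G) → Cochain μ A (m + 1)}
    (hb : ∀ g x, b (fun i => g * x i) = diagAct μ g (b x))
    (hb_lim : IsTypeILimitAt (smallInMeasure (powMeasure μ (m + 1)) (powExhaustion C (m + 1)) V)
      (powMeasure μ k) 1 fun z => dFun b (Fin.cons (α := fun _ => G) 1 z))
    (hd : ∀ x, d μ A (m + 1) (dFun b x) = 0)
    {U : (Fin k → G) × (Fin (m + 1) → G) → A} (hU : IsJointRepresentative U b)
    {H : (Fin k → G) × (Fin m → G) → A} (hH : StronglyMeasurable H)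
    (hH_equivariant : IsEquivariant H) (hH_zero : k = 0 → H = 0)
    (hUH : dLeft (U - splitVars σ) =ᵐ[biMeasure μ (k + 1) (m + 1)] dLeft (dRight H)) :
    ∃ v : (Fin k → G) → Cochain μ A m, IsDimensionShift C V σ v := by
  obtain ⟨v, hv, hdv⟩ := exists_homog_eq_dFun hV hb hb_lim hd m
  obtain ⟨U', hU', hU'_equivariant⟩ := exists_isJointRepresentative_homog hV hv
  have dRight_U'_representative := hU'.dRight
  rw [funext hdv] at dRight_U'_representative
  refine ⟨v, hv, fun x => ?_, U', hU', hU'_equivariant, (-1 : ℤ) ^ m • H, hH.const_smul _,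
    hH_equivariant.zsmul _, fun hk => by rw [hH_zero hk, smul_zero], ?_⟩
  · rw [map_dFun, funext hdv]
    exact (dFun_zsmul _ (dFun b) x).trans (by rw [dFun_dFun, smul_zero])
  · have dRight_U' : dRight U' =ᵐ[biMeasure μ (k + 1) (m + 1)] (-1 : ℤ) ^ m • dLeft U :=
      dRight_U'_representative.ae_eq_prod (hU.dLeft.zsmul _)
    filter_upwards [dRight_U', dRight_splitVars_ae_eq h hσd, hUH] with z hU'z hσz hUHz
    simp only [dRight_sub, dLeft_sub, dLeft_zsmul, dRight_zsmul, dRight_dLeft, Pi.sub_apply,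
      Pi.smul_apply] at hU'z hσz hUHz ⊢
    rw [hU'z, hσz, ← hUHz, ← smul_sub, sub_self, Pi.zero_apply]

theorem exists_isDimensionShift_zero (hV : IsNhdsChain V) {p : ℕ} {σ : (Fin (p + 1) → G) → A}
    {φ : Cochain μ A (p + 1)} (hφ : ∀ g : G, diagAct μ g φ = φ) (hdφ : d μ A (p + 1) φ = 0)
    (hσ : StronglyMeasurable σ) (hφσ : φ =ᵐ[powMeasure μ (p + 1)] σ) :
    ∃ v : (Fin 0 → G) → Cochain μ A p, IsDimensionShift C V σ v := by
  have dFun_const (x : Fin 1 → G) : dFun (fun _ : Fin 0 → G => φ) x = φ := by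
    simp only [dFun, Fin.val_eq_zero, Nat.sub_self, pow_zero, one_smul, Finset.sum_const,
      Finset.card_univ, Fintype.card_fin, zero_add]
  have hσd : dFun σ =ᵐ[powMeasure μ (p + 2)] 0 :=
    (dFun_congr μ A hφσ).symm.trans ((coeFn_d μ A φ).symm.trans (hdφ ▸ AEEqFun.coeFn_zero))
  have splitVars_representative : IsJointRepresentative
      (splitVars σ : (Fin 0 → G) × (Fin (p + 1) → G) → A) (fun _ => φ) :=
    ⟨stronglyMeasurable_splitVars hσ, fun x => by
      simpa only [splitVars, zero_concat] using hφσ.symm⟩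
  refine exists_isDimensionShift_of_dLeft_ae_eq (H := 0) hV (by omega) hσd
    (fun g _ => (hφ g).symm) ?_ (fun x => by rw [dFun_const, hdφ]) splitVars_representative
    stronglyMeasurable_const (fun g _ _ => (smul_zero g).symm) (fun _ => rfl) ?_
  · simp only [dFun_const]
    exact .const hV.smallInMeasure _ _ φ
  · have dRight_zero : dRight (0 : (Fin 0 → G) × (Fin p → G) → A) = 0 := by
      simpa only [sub_self] using dRight_sub (0 : (Fin 0 → G) × (Fin p → G) → A) 0
    rw [sub_self, dRight_zero]

theorem IsDimensionShift.exists_succ [T2Space G] (hV : IsNhdsChain V) (h : n = k + 1 + (m + 1))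
    (hσ : StronglyMeasurable σ) (hσ_equivariant : ∀ (g : G) x, σ (fun i => g * x i) = g • σ x)
    (hσd : dFun σ =ᵐ[powMeasure μ (n + 1)] 0) {v : (Fin k → G) → Cochain μ A (m + 1)}
    (hv : IsDimensionShift C V σ v) :
    ∃ v' : (Fin (k + 1) → G) → Cochain μ A m, IsDimensionShift C V σ v' := by
  obtain ⟨U, hU, hU_equivariant, H, hH, hH_equivariant, -, hUH⟩ := hv.exists_ae_eq
  obtain ⟨H', hH', hH'_equivariant, hUH'⟩ := exists_ae_eq_dRight
    ((hU.stronglyMeasurable.sub (stronglyMeasurable_splitVars hσ)).sub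
      (stronglyMeasurable_dLeft hH))
    ((hU_equivariant.sub (isEquivariant_splitVars h hσ_equivariant)).sub hH_equivariant.dLeft) hUH
  refine exists_isDimensionShift_of_dLeft_ae_eq hV (by omega) hσd (homog_translate v)
    (hv.isTypeILimitAt.dFun_homog_cons_one hV) hv.d_dFun_homog hU hH' hH'_equivariant
    (fun hk => absurd hk k.succ_ne_zero) ?_
  have := dLeft_congr hUH'
  rwa [dLeft_sub, dLeft_dLeft, sub_zero] at this

theorem exists_isDimensionShift [T2Space G] (hV : IsNhdsChain V) {p : ℕ}
    {σ : (Fin (p + 1) → G) → A} (hσ : StronglyMeasurable σ)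
    (hσ_equivariant : ∀ (g : G) x, σ (fun i => g * x i) = g • σ x)
    {φ : Cochain μ A (p + 1)} (hφ : ∀ g : G, diagAct μ g φ = φ) (hdφ : d μ A (p + 1) φ = 0)
    (hφσ : φ =ᵐ[powMeasure μ (p + 1)] σ) (h : k + m = p) :
    ∃ v : (Fin k → G) → Cochain μ A m, IsDimensionShift C V σ v := by
  have hσd : dFun σ =ᵐ[powMeasure μ (p + 2)] 0 :=
    (dFun_congr μ A hφσ).symm.trans ((coeFn_d μ A φ).symm.trans (hdφ ▸ AEEqFun.coeFn_zero))
  induction k generalizing m with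
  | zero =>
    obtain rfl : m = p := by omega
    exact exists_isDimensionShift_zero hV hφ hdφ hσ hφσ
  | succ k ih =>
    obtain ⟨v, hv⟩ := ih (m := m + 1) (by omega)
    exact hv.exists_succ hV (by omega) hσ hσ_equivariant hσd

end DimensionShift

section Regularity

variable {X : Type*} [TopologicalSpace X] [MeasurableSpace X] {ν : Measure X} {x₀ : X}
  {A : Type*} [AddCommGroup A] [TopologicalSpace A] {V : ℕ → Set A} {f : X → A}

theorem IsTypeILimitAt.exists_tendstoCompactly (hV : IsNhdsChain V)
    (hf : IsTypeILimitAt V ν x₀ f) :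
    ∃ γ : ℕ → X → A, (∀ n, IsBorelTypeIAt ν x₀ (γ n)) ∧ TendstoCompactly γ f := by
  obtain ⟨γ, hγ, hγf⟩ := hf
  refine ⟨γ, hγ, fun K hK W hW => ?_⟩
  obtain ⟨j, hj⟩ := hV.exists_subset W hW
  exact (hγf K hK j).mono fun n hn x hx => hj (hn x hx)

theorem IsTypeILimitAt.isRegularAt (hV : IsNhdsChain V) (hf : IsTypeILimitAt V ν x₀ f) :
    IsRegularAt ν f x₀ := by
  obtain ⟨γ, hγ, hγf⟩ := hf.exists_tendstoCompactly hV
  exact ⟨γ, fun n => ⟨(hγ n).isTypeI, (hγ n).locallyConstantAround⟩, hγf⟩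

theorem IsRegularAt.isAlmostTypeI (hf : IsRegularAt ν f x₀) : IsAlmostTypeI ν f := by
  obtain ⟨γ, hγ, hγf⟩ := hf
  exact ⟨γ, fun n => (hγ n).1, hγf⟩

variable [IsTopologicalAddGroup A]

theorem TendstoCompactly.tendsto {X : Type*} [TopologicalSpace X] {γ : ℕ → X → A} {f : X → A}
    (h : TendstoCompactly γ f) (x : X) : Tendsto (fun n => γ n x) atTop (𝓝 (f x)) :=
  tendsto_sub_nhds_zero_iff.1 fun W hW =>
    (h {x} isCompact_singleton W hW).mono fun _ hn => hn x rfl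

theorem TendstoCompactly.continuousAt {X : Type*} [TopologicalSpace X]
    [WeaklyLocallyCompactSpace X] (hV : IsNhdsChain V) {γ : ℕ → X → A} {f : X → A}
    (h : TendstoCompactly γ f) {x : X} (hx : ∀ n, LocallyConstantAround (γ n) x) :
    ContinuousAt f x := by
  obtain ⟨K, hK, hxK⟩ := exists_compact_mem_nhds x
  refine hV.tendsto_iff.2 fun j => ?_
  obtain ⟨n, hn⟩ := (h K hK (V (j + 1)) (hV.mem_nhds _)).exists
  filter_upwards [hxK, hx n] with y hyK hy
  simpa only [hy, sub_sub_sub_cancel_left] using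
    hV.sub_mem (hn x (mem_of_mem_nhds hxK)) (hn y hyK)

theorem IsTypeILimitAt.stronglyMeasurable [PolishSpace A] (hV : IsNhdsChain V)
    (hf : IsTypeILimitAt V ν x₀ f) : StronglyMeasurable f := by
  obtain ⟨γ, hγ, hγf⟩ := hf.exists_tendstoCompactly hV
  borelize A
  exact stronglyMeasurable_of_tendsto atTop
    (fun n => Measurable.stronglyMeasurable fun s _ => (hγ n).measurableSet_preimage s)
    (tendsto_pi_nhds.2 hγf.tendsto)

theorem IsTypeILimitAt.exists_isGδ_continuousAt [WeaklyLocallyCompactSpace X]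
    [ν.IsOpenPosMeasure] (hV : IsNhdsChain V) (hf : IsTypeILimitAt V ν x₀ f) :
    ∃ S : Set X, IsGδ S ∧ Dense S ∧ ν Sᶜ = 0 ∧ x₀ ∈ S ∧ ∀ x ∈ S, ContinuousAt f x := by
  obtain ⟨γ, hγ, hγf⟩ := hf.exists_tendstoCompactly hV
  choose O hO_open hO_mem hO_null hO_const using fun n => (hγ n).exists_isOpen
  have iInter_null : ν (⋂ n, O n)ᶜ = 0 := by
    rw [Set.compl_iInter]
    exact measure_iUnion_null hO_null
  exact ⟨⋂ n, O n, .iInter_of_isOpen hO_open, Measure.dense_of_ae (mem_ae_iff.2 iInter_null),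
    iInter_null, Set.mem_iInter.2 hO_mem, fun x hx =>
      hγf.continuousAt hV fun n => hO_const n x (Set.mem_iInter.1 hx n)⟩

end Regularity

section Classes

variable {G : Type*} [Group G] [TopologicalSpace G] [IsTopologicalGroup G]
  [LocallyCompactSpace G] [SecondCountableTopology G]
  [MeasurableSpace G] [BorelSpace G] {μ : Measure G} [μ.IsHaarMeasure]
  {A : Type*} [AddCommGroup A] [TopologicalSpace A] [IsTopologicalAddGroup A]

theorem d_mk {n : ℕ} {f : (Fin n → G) → A} (hf : StronglyMeasurable f) :
    d μ A n (AEEqFun.mk f hf.aestronglyMeasurable) =ᵐ[powMeasure μ (n + 1)] dFun f :=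
  (coeFn_d μ A _).trans (dFun_congr μ A (AEEqFun.coeFn_mk _ _))

variable [DistribMulAction G A] [ContinuousSMul G A]

theorem mk_mem_invariants {n : ℕ} {f : (Fin n → G) → A} (hf : StronglyMeasurable f)
    (hf_equivariant : ∀ (g : G) x, f (fun i => g * x i) = g • f x) :
    AEEqFun.mk f hf.aestronglyMeasurable ∈ invariants μ A n := by
  have coeFn_f := AEEqFun.coeFn_mk (μ := powMeasure μ n) f hf.aestronglyMeasurable
  refine AddSubgroup.mem_iInf.2 fun g => AEEqFun.ext ((coeFn_diagAct μ A g _).trans ?_)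
  filter_upwards [coeFn_f,
    (measurePreserving_translate μ n g⁻¹).quasiMeasurePreserving.ae coeFn_f] with x hx hgx
  rw [hgx, hf_equivariant, smul_inv_smul]
  exact hx.symm

theorem mk_mem_cocycles {p : ℕ} {f : (Fin (p + 1) → G) → A} (hf : StronglyMeasurable f)
    (hf_equivariant : ∀ (g : G) x, f (fun i => g * x i) = g • f x) (hdf : ∀ x, dFun f x = 0) :
    AEEqFun.mk f hf.aestronglyMeasurable ∈ cocycles μ A p :=
  ⟨mk_mem_invariants hf hf_equivariant,
    AEEqFun.ext ((d_mk hf).trans (funext hdf ▸ AEEqFun.coeFn_zero.symm))⟩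

theorem mem_coboundaries_of_ae_eq_dFun {p : ℕ} {φ : Cochain μ A (p + 1)} {w : (Fin p → G) → A}
    (hw : StronglyMeasurable w) (hw_equivariant : ∀ (g : G) x, w (fun i => g * x i) = g • w x)
    (hw_zero : p = 0 → w = 0) (hφw : φ =ᵐ[powMeasure μ (p + 1)] dFun w) :
    φ ∈ coboundaries μ A p := by
  have d_mk_eq : d μ A p (AEEqFun.mk w hw.aestronglyMeasurable) = φ :=
    AEEqFun.ext ((d_mk hw).trans hφw.symm)
  cases p with
  | zero =>
    obtain rfl := hw_zero rfl
    exact d_mk_eq.symm.trans (map_zero (d μ A 0))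
  | succ p => exact ⟨_, mk_mem_invariants hw hw_equivariant, d_mk_eq⟩

variable [PolishSpace A]

theorem exists_isTypeILimitAt_sub_ae_eq_dFun [T2Space G] {V : ℕ → Set A} (hV : IsNhdsChain V)
    {p : ℕ} {φ : Cochain μ A (p + 1)} (hφ : φ ∈ cocycles μ A p) :
    ∃ f : (Fin (p + 1) → G) → A, IsTypeILimitAt V (powMeasure μ (p + 1)) 1 f ∧
      (∀ (g : G) x, f (fun i => g * x i) = g • f x) ∧ (∀ x, dFun f x = 0) ∧
      ∃ w : (Fin p → G) → A, StronglyMeasurable w ∧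
        (∀ (g : G) x, w (fun i => g * x i) = g • w x) ∧ (p = 0 → w = 0) ∧
        (fun x => f x - φ x) =ᵐ[powMeasure μ (p + 1)] dFun w := by
  have hφ_fixed (g : G) : diagAct μ g φ = φ := AddSubgroup.mem_iInf.1 hφ.1 g
  obtain ⟨σ, hσ, hσ_equivariant, hφσ⟩ := exists_equivariant_ae_eq φ hφ_fixed
  obtain ⟨v, hv⟩ := exists_isDimensionShift (C := default) (m := 0) hV hσ hσ_equivariant hφ_fixed
    hφ.2 hφσ p.add_zero
  obtain ⟨U, hU, -, H, hH, hH_equivariant, hH_zero, hUH⟩ := hv.exists_ae_eq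
  refine ⟨fun x => evalZero μ A (homog v x), (hv.isTypeILimitAt.homog hV).map (evalZero μ A)
    fun n => ⟨n + 1, fun a ha => hV.antitone n.le_succ (evalZero_mem ha)⟩, fun g x => ?_,
    fun x => ?_, fun x => H (x, default), hH.comp_measurable measurable_prodMk_right,
    fun g x => ?_, fun hp => ?_, ?_⟩
  · simp only [homog_translate, evalZero_diagAct]
  · rw [← map_dFun, evalZero_eq_zero_of_d_eq_zero (hv.d_dFun_homog x)]
  · rw [← hH_equivariant, Subsingleton.elim (fun i => g * (default : Fin 0 → G) i) default]
  · rw [hH_zero hp]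
    rfl
  · filter_upwards [hφσ, Measure.ae_ae_of_ae_prod (ae_eq_zero_of_dRight_ae_eq_zero hUH)]
      with x hφσx hUHx
    have difference_zero := forall_of_ae_powMeasure_zero hUHx default
    simp only [Pi.sub_apply, splitVars, concat_zero, Pi.zero_apply, sub_eq_zero] at difference_zero
    have hUx : U (x, default) = evalZero μ A (homog v x) :=
      forall_of_ae_powMeasure_zero (hU.ae_eq x) default
    rw [← hUx, hφσx, difference_zero]
    rfl

end Classes

end MooreCohomology

open MooreCohomology in
theorem theoremB {G : Type*} [Group G] [TopologicalSpace G] [IsTopologicalGroup G]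
    [LocallyCompactSpace G] [SecondCountableTopology G] [T2Space G]
    [MeasurableSpace G] [BorelSpace G] (μ : MeasureTheory.Measure G) [μ.IsHaarMeasure]
    {A : Type*} [AddCommGroup A] [TopologicalSpace A] [IsTopologicalAddGroup A] [PolishSpace A]
    [DistribMulAction G A] [ContinuousSMul G A]
    (p : ℕ) (c : MooreCohomology.Hm μ A p) :
    ∃ (f : (Fin (p + 1) → G) → A) (hf : StronglyMeasurable f)
      (z : MooreCohomology.cocycles μ A p),
      -- `f` represents the class `c`
      (z : MooreCohomology.Cochain μ A (p + 1)) = AEEqFun.mk f hf.aestronglyMeasurable ∧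
      QuotientAddGroup.mk z = c ∧
      -- `f` is equivariant and satisfies the cocycle identity at every point
      (∀ (g : G) (x : Fin (p + 1) → G), f (fun i => g * x i) = g • f x) ∧
      (∀ x : Fin (p + 2) → G, MooreCohomology.dFun f x = 0) ∧
      -- `f` is almost type-I and regular at the identity
      MooreCohomology.IsAlmostTypeI (MooreCohomology.powMeasure μ (p + 1)) f ∧
      MooreCohomology.IsRegularAt (MooreCohomology.powMeasure μ (p + 1)) f 1 ∧
      -- `f` is continuous at every point of a dense `G_δ` set of full measure containing `1`
      ∃ S : Set (Fin (p + 1) → G), IsGδ S ∧ Dense S ∧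
        MooreCohomology.powMeasure μ (p + 1) Sᶜ = 0 ∧ 1 ∈ S ∧ ∀ x ∈ S, ContinuousAt f x := by
  obtain ⟨z₀, rfl⟩ := QuotientAddGroup.mk_surjective c
  obtain ⟨V, hV⟩ := exists_isNhdsChain (A := A)
  obtain ⟨f, hf_lim, hf_equivariant, hdf, w, hw, hw_equivariant, hw_zero, hfw⟩ :=
    exists_isTypeILimitAt_sub_ae_eq_dFun hV z₀.2
  have hf : StronglyMeasurable f := hf_lim.stronglyMeasurable hV
  have hf_regular := hf_lim.isRegularAt hV
  refine ⟨f, hf, ⟨_, mk_mem_cocycles hf hf_equivariant hdf⟩, rfl, ?_, hf_equivariant, hdf,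
    hf_regular.isAlmostTypeI, hf_regular, hf_lim.exists_isGδ_continuousAt hV⟩
  rw [eq_comm, QuotientAddGroup.eq, neg_add_eq_sub]
  refine mem_coboundaries_of_ae_eq_dFun hw hw_equivariant hw_zero ?_
  filter_upwards [hfw, AEEqFun.coeFn_sub (AEEqFun.mk f hf.aestronglyMeasurable) z₀.1,
    AEEqFun.coeFn_mk (μ := powMeasure μ (p + 1)) f hf.aestronglyMeasurable] with x hfwx hsub hmk
  exact hsub.trans ((congrArg (· - z₀.1 x) hmk).trans hfwx)
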